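/- Let $\mathbb S$ be the space of symmetric real $2\times 2$ matrices. For a bounded open set $G\subset\mathbb R^2$ let $$H(\operatorname{div}\mathbf{div},G;\mathbb S)=\{\tau\in L^2(G;\mathbb S):\ \operatorname{div}\mathbf{div}\,\tau\in L^2(G)\},$$ where $\operatorname{div}\mathbf{div}\,\tau=\sum_{i,j}\partial_i\partial_j\tau_{ij}$ in the sense of distributions. A polygon $K$ is the bounded open region enclosed by a simple closed polygonal chain (not necessarily convex; straight angles at vertices are allowed); $n_K$ is its outward unit normal, and for a unit normal $n=(n_1,n_2)^{\intercal}$ of an edge, $t=(-n_2,n_1)^{\intercal}$. For $\tau\in H(\operatorname{div}\mathbf{div},K;\mathbb S)$ the traces on $\partial K$ are understood in the weak sense, with $n=n_K$: * the normal-normal trace $n^{\intercal}\tau n$ is the functional $\langle n^{\intercal}\tau n,\partial_n v\rangle=(\tau,\nabla^2v)_K-(\operatorname{div}\mathbf{div}\,\tau,v)_K$ for functions $v$ with $v=0$ on $\partial K$; it belongs to $L^2(e)$ on an edge $e$ and equals $g\in L^2(e)$ there if $\langle n^{\intercal}\tau n,\partial_n v\rangle=\int_e g\,\partial_n v\,ds$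 for all such $v\in C^\infty(\mathbb R^2)$ with $\partial_n v=0$ on the other edges of $K$; * the effective shear force $\partial_t(t^{\intercal}\tau n)+n^{\intercal}\mathbf{div}\,\tau$ is the functional $v\mapsto(\operatorname{div}\mathbf{div}\,\tau,v)_K-(\tau,\nabla^2v)_K$ for functions $v$ with $\partial_nv=0$ on $\partial K$ and $v=0$ at the vertices of $K$; it belongs to $L^2(e)$ on an edge $e$ and equals $g\in L^2(e)$ there if its value is $\int_e g\,v\,ds$ for all such $v\in C^\infty(\mathbb R^2)$ with $v=0$ on the other edges of $K$. If it is formed with $-n_K$ in place of $n_K$, it changes sign. For $\tau$ smooth up to $\partial K$ these are the ordinary traces. The value $\tau|_K(\delta)$ at a vertex $\delta$ of $K$ is $A$ if $|K\cap B_r(\delta)|^{-1}\int_{K\cap B_r(\delta)}|\tau-A|\,dx\to0$ as $r\to0$; for $\tau|_K$ continuous up to $\delta$ this is the ordinary value. **Lemma.** Let $\mathcal T_h$ be a finite polygonal mesh of the bounded open set $\Omega\subset\mathbb R^2$: finitely many pairwise disjoint polygons $K$ such that $\Omega$ is the interior of $\bigcup_K\overline K$, and such that any two edges of different cells coincide or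 meet at most in common end points. Call an edge interior if its relative interior lies in $\Omega$, and a vertex interior if it lies in $\Omega$; fix a unit normal $n_e$ on each interior edge $e$ and let $t_e$ be the corresponding tangent. Let $\tau\in L^2(\Omega;\mathbb S)$ be such that 1. $\tau|_K\in H(\operatorname{div}\mathbf{div},K;\mathbb S)$ for each $K\in\mathcal T_h$; 2. for each interior edge $e$, $(n^{\intercal}\tau n)|_e\in L^2(e)$ is single-valued, that is, all cells having $e$ as an edge give the same function in $L^2(e)$; 3. for each interior edge $e$, $(\partial_{t_e}(t^{\intercal}\tau n)+n_e^{\intercal}\mathbf{div}\,\tau)|_e\in L^2(e)$, formed with the fixed normal $n_e$, is single-valued in the same sense; 4. for each interior vertex $\delta$, $\tau(\delta)$ is single-valued: the values $\tau|_K(\delta)$ of all cells $K$ having $\delta$ as a vertex exist and coincide. Then $\tau\in H(\operatorname{div}\mathbf{div},\Omega;\mathbb S)$. -/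

import Mathlib

open MeasureTheory Set Filter Topology
open scoped ContDiff

noncomputable section

namespace DivDiv

/-- The Euclidean plane. -/
abbrev Plane : Type := EuclideanSpace ℝ (Fin 2)

/-- The unit normal to the segment from `a` to `b` that points to the right of the direction
of travel. With `n` this normal and `t = (-n₂, n₁)`, the vector `t` is `(b - a) / |b - a|`. -/
def rightNormal (a b : Plane) : Plane :=
  ‖b - a‖⁻¹ • !₂[(b - a) 1, -((b - a) 0)]

/-- Arc length on the segment from `a` to `b`, as a measure on the plane. -/
def arcLength (a b : Plane) : Measure Plane :=
  ENNReal.ofReal (dist a b) •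
    (volume.restrict (Icc (0 : ℝ) 1)).map (fun s => AffineMap.lineMap (k := ℝ) a b s)

/-- A simple (not necessarily convex) polygon: a closed chain of at least three vertices, listed
counterclockwise, whose edges do not cross, together with the open region `inside` it bounds.
Straight angles at vertices are allowed, so hanging nodes of a mesh are ordinary vertices. -/
structure SimplePolygon where
  /-- number of vertices -/
  n : ℕ
  three_le : 3 ≤ n
  /-- the vertices, in cyclic order -/
  vertex : ZMod n → Plane
  vertex_injective : Function.Injective vertex
  edges_simple : ∀ k l : ZMod n, k ≠ l →
    Disjoint (openSegment ℝ (vertex k) (vertex (k + 1))) (segment ℝ (vertex l) (vertex (l + 1)))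
  /-- the open region bounded by the chain -/
  inside : Set Plane
  isOpen_inside : IsOpen inside
  isConnected_inside : IsConnected inside
  isBounded_inside : Bornology.IsBounded inside
  frontier_inside : frontier inside = ⋃ k : ZMod n, segment ℝ (vertex k) (vertex (k + 1))
  /-- counterclockwise: the region lies to the left of each edge, its complement to the right -/
  counterclockwise : ∀ k : ZMod n, ∀ x ∈ openSegment ℝ (vertex k) (vertex (k + 1)),
    ∀ᶠ s in 𝓝[>] (0 : ℝ),
      x - s • rightNormal (vertex k) (vertex (k + 1)) ∈ inside ∧
      x + s • rightNormal (vertex k) (vertex (k + 1)) ∉ inside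

namespace SimplePolygon

/-- The `k`-th closed edge. -/
def edge (K : SimplePolygon) (k : ZMod K.n) : Set Plane :=
  segment ℝ (K.vertex k) (K.vertex (k + 1))

/-- The `k`-th edge without its end points. -/
def openEdge (K : SimplePolygon) (k : ZMod K.n) : Set Plane :=
  openSegment ℝ (K.vertex k) (K.vertex (k + 1))

/-- The outward unit normal `n_K` on the `k`-th edge. -/
def normal (K : SimplePolygon) (k : ZMod K.n) : Plane :=
  rightNormal (K.vertex k) (K.vertex (k + 1))

/-- Arc length on the `k`-th edge. -/
def edgeMeasure (K : SimplePolygon) (k : ZMod K.n) : Measure Plane :=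
  arcLength (K.vertex k) (K.vertex (k + 1))

end SimplePolygon

/-- The finite family `T` is an (edge-to-edge) polygonal mesh of `Ω`: the cells do not overlap,
their closures fill up `Ω`, and two edges of different cells either coincide or meet at most in
common end points. -/
structure IsPolygonalMesh {ι : Type*} (Ω : Set Plane) (T : ι → SimplePolygon) : Prop where
  finite : Finite ι
  disjoint : ∀ i j, i ≠ j → Disjoint (T i).inside (T j).inside
  fills : Ω = interior (⋃ i, closure (T i).inside)
  conforming : ∀ i j, i ≠ j → ∀ (k : ZMod (T i).n) (l : ZMod (T j).n),
    (T i).edge k = (T j).edge l ∨ Disjoint ((T i).openEdge k) ((T j).edge l)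

/-- Partial derivative `∂ᵢ v`. -/
def pderiv (i : Fin 2) (v : Plane → ℝ) (x : Plane) : ℝ :=
  fderiv ℝ v x (EuclideanSpace.single i 1)

/-- Derivative of `v` at `x` in the direction `ν`. -/
def dirDeriv (ν : Plane) (v : Plane → ℝ) (x : Plane) : ℝ :=
  fderiv ℝ v x ν

/-- The pointwise contraction `τ : ∇²v`. -/
def contractHess (τ : Plane → Matrix (Fin 2) (Fin 2) ℝ) (v : Plane → ℝ) (x : Plane) : ℝ :=
  ∑ i, ∑ j, τ x i j * pderiv i (pderiv j v) x

/-- `τ ∈ L²(U; 𝕊)`. -/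
def MemL2Sym (U : Set Plane) (τ : Plane → Matrix (Fin 2) (Fin 2) ℝ) : Prop :=
  (∀ i j, MemLp (fun x => τ x i j) 2 (volume.restrict U)) ∧
    ∀ᵐ x ∂(volume.restrict U), (τ x).IsSymm

/-- `f ∈ L²(U)` is the distributional `div div τ` in the open set `U`. -/
def IsWeakDivDiv (U : Set Plane) (τ : Plane → Matrix (Fin 2) (Fin 2) ℝ) (f : Plane → ℝ) : Prop :=
  MemLp f 2 (volume.restrict U) ∧
    ∀ v : Plane → ℝ, ContDiff ℝ ∞ v → HasCompactSupport v → tsupport v ⊆ U →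
      ∫ x in U, f x * v x = ∫ x in U, contractHess τ v x

/-- `τ ∈ H(div div, U; 𝕊)`. -/
def MemHDivDiv (U : Set Plane) (τ : Plane → Matrix (Fin 2) (Fin 2) ℝ) : Prop :=
  MemL2Sym U τ ∧ ∃ f, IsWeakDivDiv U τ f

/-- For `τ ∈ H(div div, K; 𝕊)`: the normal-normal trace `nᵀτn` of `τ|_K` on the `k`-th edge `e`
is the function `g ∈ L²(e)`. The trace is the functional
`⟨nᵀτn, ∂ₙv⟩ = (τ, ∇²v)_K - (div div τ, v)_K` on the normal derivatives `∂ₙv|_∂K` of functions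
`v` that vanish on `∂K`; its restriction to `e` acts on those `∂ₙv` that vanish on the
other edges. (`div div τ` is unique up to null sets, so `∀ f` ranges over its representatives.) -/
def HasNormalNormalTrace (K : SimplePolygon) (τ : Plane → Matrix (Fin 2) (Fin 2) ℝ)
    (k : ZMod K.n) (g : Plane → ℝ) : Prop :=
  MemLp g 2 (K.edgeMeasure k) ∧
    ∀ f, IsWeakDivDiv K.inside τ f →
      ∀ v : Plane → ℝ, ContDiff ℝ ∞ v →
        (∀ x ∈ frontier K.inside, v x = 0) →
        (∀ l, l ≠ k → ∀ x ∈ K.edge l, dirDeriv (K.normal l) v x = 0) →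
        (∫ x in K.inside, contractHess τ v x) - (∫ x in K.inside, f x * v x) =
          ∫ x, g x * dirDeriv (K.normal k) v x ∂(K.edgeMeasure k)

/-- For `τ ∈ H(div div, K; 𝕊)`: the effective shear force
`∂_t(tᵀτn) + nᵀ div τ` of `τ|_K` on the `k`-th edge `e`, formed with the unit normal `n = ν`
of `e` (one of `± n_K`) and `t = (-n₂, n₁)`, is the function `g ∈ L²(e)`. With `n = n_K` the
trace is the functional `v|_∂K ↦ (div div τ, v)_K - (τ, ∇²v)_K` on functions `v` with
`∂ₙv = 0` on `∂K` and `v = 0` at the vertices; its restriction to `e` acts on those `v` that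
vanish on the other edges. It changes sign with the normal, whence the factor `n_K · ν = ± 1`. -/
def HasShearTrace (K : SimplePolygon) (τ : Plane → Matrix (Fin 2) (Fin 2) ℝ)
    (k : ZMod K.n) (ν : Plane) (g : Plane → ℝ) : Prop :=
  MemLp g 2 (K.edgeMeasure k) ∧
    ∀ f, IsWeakDivDiv K.inside τ f →
      ∀ v : Plane → ℝ, ContDiff ℝ ∞ v →
        (∀ l, ∀ x ∈ K.edge l, dirDeriv (K.normal l) v x = 0) →
        (∀ l, l ≠ k → ∀ x ∈ K.edge l, v x = 0) →
        (∫ x in K.inside, f x * v x) - (∫ x in K.inside, contractHess τ v x) =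
          inner ℝ (K.normal k) ν * ∫ x, g x * v x ∂(K.edgeMeasure k)

/-- The value of `τ|_K` at the point `δ` of the closure of `K` is `A`, in Lebesgue's sense. For
`τ|_K` continuous up to `δ` this is the ordinary value of the continuous extension. -/
def HasValueAt (K : SimplePolygon) (τ : Plane → Matrix (Fin 2) (Fin 2) ℝ)
    (δ : Plane) (A : Matrix (Fin 2) (Fin 2) ℝ) : Prop :=
  ∀ i j, Tendsto (fun r : ℝ => ⨍ x in K.inside ∩ Metric.ball δ r, |τ x i j - A i j|)
    (𝓝[>] 0) (𝓝 0)

end DivDiv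

end

namespace DivDiv

/-! ### Partial derivatives and the Hessian contraction -/

/-! Glue the cellwise div div into one `f ∈ L²(Ω)`. For a test function `v`, the `defect` of a cell
is `(f, v)_K - (τ, ∇²v)_K`, and the theorem says that the defects sum to zero. This sum is additive
in `v`, so a partition of unity (`test_induction`) reduces the claim to test functions supported
near one point of `Ω`.

Inside a cell the claim is the definition of the weak div div. An interior edge separates exactly
two cells, which traverse it in opposite directions (`exists_neighbour`). Near it `v = v₁ + v₂` with
`v₁ = 0` and `∂ₙv₂ = 0` on the edge (`exists_trace_splitting`). The defects on `v₁` see only the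
normal-normal trace, those on `v₂` only the shear trace; both are odd in the outward normal, so the
two sides cancel (`sum_defect_eq_zero_near_edge`).

The traces do not exclude a defect concentrated at a vertex `δ`, such as a multiple of `v(δ)`. Write
`v = v(1 - φ_r) + vφ_r` with a cut-off `φ_r` at scale `r`. The first part avoids `δ` and is covered
by the previous cases. The Hessian of the second is `O(r⁻²)` on a disc of area `O(r²)`, which is
only bounded; but `τ` may be replaced by `τ - A`, where `A` is the common vertex value, since `∫ A :
∇²w = 0` over the whole disc, and then the contribution tends to zero
(`sum_defect_eq_zero_near_vertex`). -/

lemma contDiff_pderiv {v : Plane → ℝ} (hv : ContDiff ℝ ∞ v) (i : Fin 2) :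
    ContDiff ℝ ∞ (pderiv i v) :=
  (hv.fderiv_right (m := ∞) le_rfl).clm_apply contDiff_const

lemma tsupport_pderiv_subset (v : Plane → ℝ) (i : Fin 2) : tsupport (pderiv i v) ⊆ tsupport v :=
  tsupport_fderiv_apply_subset ℝ _

lemma hasCompactSupport_pderiv {v : Plane → ℝ} (hv : HasCompactSupport v) (i : Fin 2) :
    HasCompactSupport (pderiv i v) :=
  hv.fderiv_apply ℝ _

lemma pderiv_add {u v : Plane → ℝ} (hu : ContDiff ℝ ∞ u) (hv : ContDiff ℝ ∞ v) (i : Fin 2) :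
    pderiv i (u + v) = pderiv i u + pderiv i v := by
  ext x
  have h1 := (hu.differentiable (by simp)) x
  have h2 := (hv.differentiable (by simp)) x
  simp [pderiv, fderiv_add h1 h2]

lemma pderiv_mul {u v : Plane → ℝ} (hu : ContDiff ℝ ∞ u) (hv : ContDiff ℝ ∞ v) (i : Fin 2) :
    pderiv i (u * v) = u * pderiv i v + v * pderiv i u := by
  ext x
  have h1 := (hu.differentiable (by simp)) x
  have h2 := (hv.differentiable (by simp)) x
  simp [pderiv, fderiv_mul h1 h2]

lemma pderiv_pderiv_add {u v : Plane → ℝ} (hu : ContDiff ℝ ∞ u) (hv : ContDiff ℝ ∞ v)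
    (i j : Fin 2) :
    pderiv i (pderiv j (u + v)) = pderiv i (pderiv j u) + pderiv i (pderiv j v) := by
  rw [pderiv_add hu hv, pderiv_add (contDiff_pderiv hu j) (contDiff_pderiv hv j)]

lemma pderiv_pderiv_mul {u v : Plane → ℝ} (hu : ContDiff ℝ ∞ u) (hv : ContDiff ℝ ∞ v)
    (i j : Fin 2) :
    pderiv i (pderiv j (u * v)) = u * pderiv i (pderiv j v) + pderiv j v * pderiv i u +
      (v * pderiv i (pderiv j u) + pderiv j u * pderiv i v) := by
  have hu' := contDiff_pderiv hu j
  have hv' := contDiff_pderiv hv j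
  have h1 : ContDiff ℝ ∞ (u * pderiv j v) := hu.mul hv'
  have h2 : ContDiff ℝ ∞ (v * pderiv j u) := hv.mul hu'
  rw [pderiv_mul hu hv, pderiv_add h1 h2, pderiv_mul hu hv',
    pderiv_mul hv hu']

/-- The rescaling `x ↦ φ ((x - δ) / r)`. -/
noncomputable def rescale (φ : Plane → ℝ) (δ : Plane) (r : ℝ) (x : Plane) : ℝ := φ (r⁻¹ • (x - δ))

lemma contDiff_rescale {φ : Plane → ℝ} (hφ : ContDiff ℝ ∞ φ) (δ : Plane) (r : ℝ) :
    ContDiff ℝ ∞ (rescale φ δ r) :=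
  hφ.comp ((contDiff_id.sub contDiff_const).const_smul r⁻¹)

lemma pderiv_rescale {φ : Plane → ℝ} (hφ : ContDiff ℝ ∞ φ) (δ : Plane) (r : ℝ) (i : Fin 2) :
    pderiv i (rescale φ δ r) = r⁻¹ • rescale (pderiv i φ) δ r := by
  ext x
  have h1 : HasFDerivAt (fun y : Plane => r⁻¹ • (y - δ))
      (r⁻¹ • ContinuousLinearMap.id ℝ Plane) x :=
    ((hasFDerivAt_id x).sub_const δ).const_smul r⁻¹
  have h2 := ((hφ.differentiable (by simp)) (r⁻¹ • (x - δ))).hasFDerivAt.comp x h1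
  have h3 : fderiv ℝ (rescale φ δ r) x = _ := h2.fderiv
  simp [pderiv, h3, rescale]

lemma pderiv_const_smul {φ : Plane → ℝ} (hφ : ContDiff ℝ ∞ φ) (c : ℝ) (i : Fin 2) :
    pderiv i (c • φ) = c • pderiv i φ := by
  ext x
  simp [pderiv, fderiv_const_smul ((hφ.differentiable (by simp)) x) c]

lemma exists_bound_of_test {v : Plane → ℝ} (hv : ContDiff ℝ ∞ v) (hc : HasCompactSupport v) :
    ∃ C, 0 ≤ C ∧ ∀ x, |v x| ≤ C := by
  obtain ⟨C, hC⟩ := hc.exists_bound_of_continuous hv.continuous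
  exact ⟨C, (norm_nonneg _).trans (hC 0), hC⟩

/-- The second derivatives of `v φ((x - δ) / r)` are `O(r⁻²)`. -/
lemma exists_bound_pderiv_pderiv_mul_rescale {v φ : Plane → ℝ} (hv : ContDiff ℝ ∞ v)
    (hvc : HasCompactSupport v) (hφ : ContDiff ℝ ∞ φ) (hφc : HasCompactSupport φ) (δ : Plane)
    (i j : Fin 2) :
    ∃ C, ∀ r, 0 < r → r ≤ 1 → ∀ x,
      |pderiv i (pderiv j (v * rescale φ δ r)) x| ≤ C * (r ^ 2)⁻¹ := by
  have bd : ∀ u : Plane → ℝ, ContDiff ℝ ∞ u → HasCompactSupport u → ∃ C, 0 ≤ C ∧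
      (∀ x, |u x| ≤ C) ∧ (∀ m x, |pderiv m u x| ≤ C) ∧
      ∀ m l x, |pderiv m (pderiv l u) x| ≤ C := by
    intro u hu hc
    obtain ⟨C0, h0, h0'⟩ := exists_bound_of_test hu hc
    choose C1 h1 h1' using fun m =>
      exists_bound_of_test (contDiff_pderiv hu m) (hasCompactSupport_pderiv hc m)
    choose C2 h2 h2' using fun m l => exists_bound_of_test
      (contDiff_pderiv (contDiff_pderiv hu l) m)
      (hasCompactSupport_pderiv (hasCompactSupport_pderiv hc l) m)
    have e1 : ∀ m, C1 m ≤ ∑ m, C1 m := fun m =>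
      Finset.single_le_sum (f := C1) (fun m _ => h1 m) (Finset.mem_univ m)
    have e2' : ∀ m, 0 ≤ ∑ l, C2 m l := fun m => Finset.sum_nonneg fun l _ => h2 m l
    have e2 : ∀ m l, C2 m l ≤ ∑ m, ∑ l, C2 m l := fun m l =>
      (Finset.single_le_sum (f := C2 m) (fun l _ => h2 m l) (Finset.mem_univ l)).trans
        (Finset.single_le_sum (f := fun m => ∑ l, C2 m l) (fun m _ => e2' m) (Finset.mem_univ m))
    have s1 : 0 ≤ ∑ m, C1 m := Finset.sum_nonneg fun m _ => h1 m
    have s2 : 0 ≤ ∑ m, ∑ l, C2 m l := Finset.sum_nonneg fun m _ => e2' m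
    refine ⟨C0 + ∑ m, C1 m + ∑ m, ∑ l, C2 m l, by positivity, fun x => ?_, fun m x => ?_,
      fun m l x => ?_⟩
    · linarith [h0' x]
    · linarith [h1' m x, e1 m]
    · linarith [h2' m l x, e2 m l]
  obtain ⟨C, hC, c0, c1, c2⟩ := bd v hv hvc
  obtain ⟨D, hD, d0, d1, d2⟩ := bd φ hφ hφc
  -- The product rule gives four terms, each at most `C * D` times a power of `r⁻¹` not exceeding
  -- the second; `r ≤ 1` raises all powers to `r⁻²`.
  refine ⟨4 * (C * D), fun r hr hr1 x => ?_⟩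
  have hs := contDiff_rescale hφ δ r
  rw [pderiv_pderiv_mul hv hs, pderiv_rescale hφ, pderiv_rescale hφ,
    pderiv_const_smul (contDiff_rescale (contDiff_pderiv hφ j) δ r),
    pderiv_rescale (contDiff_pderiv hφ j)]
  simp only [Pi.add_apply, Pi.mul_apply, Pi.smul_apply, smul_eq_mul, rescale]
  set y := r⁻¹ • (x - δ)
  have hq : 1 ≤ r⁻¹ := (one_le_inv₀ hr).2 hr1
  have hq0 : 0 ≤ r⁻¹ := by positivity
  rw [← inv_pow]
  set q := r⁻¹
  have m0 : |v x * (q * (q * pderiv i (pderiv j φ) y))| ≤ C * D * q ^ 2 := by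
    rw [abs_mul, abs_mul, abs_mul, abs_of_nonneg hq0]
    calc _ ≤ C * (q * (q * D)) := by gcongr; exacts [c0 x, d2 i j y]
      _ = _ := by ring
  have m1 : |q * pderiv j φ y * pderiv i v x| ≤ C * D * q ^ 2 := by
    rw [abs_mul, abs_mul, abs_of_nonneg hq0]
    calc _ ≤ q * D * C := by gcongr; exacts [d1 j y, c1 i x]
      _ = C * D * q := by ring
      _ ≤ _ := by gcongr; nlinarith
  have m2 : |φ y * pderiv i (pderiv j v) x| ≤ C * D * q ^ 2 := by
    rw [abs_mul]
    calc _ ≤ D * C := by gcongr; exacts [d0 y, c2 i j x]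
      _ = C * D * 1 := by ring
      _ ≤ _ := by gcongr; nlinarith
  have m3 : |pderiv j v x * (q * pderiv i φ y)| ≤ C * D * q ^ 2 := by
    rw [abs_mul, abs_mul, abs_of_nonneg hq0]
    calc _ ≤ C * (q * D) := by gcongr; exacts [c1 j x, d1 i y]
      _ = C * D * q := by ring
      _ ≤ _ := by gcongr; nlinarith
  calc _ ≤ _ := (abs_add_le _ _).trans (add_le_add (abs_add_le _ _) (abs_add_le _ _))
    _ ≤ 4 * (C * D) * q ^ 2 := by linarith

/-- A compactly supported partial derivative integrates to zero. -/
lemma integral_pderiv_eq_zero {v : Plane → ℝ} (hv : ContDiff ℝ ∞ v) (hc : HasCompactSupport v)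
    (i : Fin 2) : ∫ x, pderiv i v x = 0 := by
  have h1 : Integrable (fun x => fderiv ℝ v x (EuclideanSpace.single i 1)) :=
    (contDiff_pderiv hv i).continuous.integrable_of_hasCompactSupport
      (hasCompactSupport_pderiv hc i)
  have h2 : Integrable v := hv.continuous.integrable_of_hasCompactSupport hc
  have := integral_mul_fderiv_eq_neg_fderiv_mul_of_integrable (μ := (volume : Measure Plane))
    (f := fun _ => (1 : ℝ)) (g := v) (v := EuclideanSpace.single i 1)
    (by simp) (by simpa using h1) (by simpa using h2) (by simp)
    (fun x _ => hv.differentiable (by simp) x)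
  simpa [pderiv] using this

lemma contractHess_eq_zero {v : Plane → ℝ} {x : Plane} (hx : x ∉ tsupport v)
    (τ : Plane → Matrix (Fin 2) (Fin 2) ℝ) : contractHess τ v x = 0 := by
  refine Finset.sum_eq_zero fun i _ => Finset.sum_eq_zero fun j _ => ?_
  have : x ∉ tsupport (pderiv i (pderiv j v)) := fun h =>
    hx (tsupport_pderiv_subset _ _ (tsupport_pderiv_subset _ _ h))
  rw [image_eq_zero_of_notMem_tsupport this, mul_zero]

lemma memLp_pderiv_pderiv {v : Plane → ℝ} (hv : ContDiff ℝ ∞ v) (hc : HasCompactSupport v)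
    (U : Set Plane) (i j : Fin 2) : MemLp (pderiv i (pderiv j v)) 2 (volume.restrict U) :=
  (contDiff_pderiv (contDiff_pderiv hv j) i).continuous.memLp_of_hasCompactSupport
    (hasCompactSupport_pderiv (hasCompactSupport_pderiv hc j) i)

lemma integrableOn_contractHess {U : Set Plane} {τ : Plane → Matrix (Fin 2) (Fin 2) ℝ}
    (hτ : ∀ i j, MemLp (fun x => τ x i j) 2 (volume.restrict U)) {v : Plane → ℝ}
    (hv : ContDiff ℝ ∞ v) (hc : HasCompactSupport v) :
    IntegrableOn (contractHess τ v) U := by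
  refine integrable_finsetSum _ fun i _ => integrable_finsetSum _ fun j _ => ?_
  exact (hτ i j).integrable_mul (memLp_pderiv_pderiv hv hc U i j)

lemma integrableOn_mul {U : Set Plane} {f : Plane → ℝ} (hf : MemLp f 2 (volume.restrict U))
    {v : Plane → ℝ} (hv : ContDiff ℝ ∞ v) (hc : HasCompactSupport v) :
    IntegrableOn (fun x => f x * v x) U :=
  hf.integrable_mul (q := 2) (hv.continuous.memLp_of_hasCompactSupport hc)

/-! ### The defect functional -/

/-- The functional `v ↦ (f, v)_U - (τ, ∇²v)_U`. -/
noncomputable def defect (U : Set Plane) (τ : Plane → Matrix (Fin 2) (Fin 2) ℝ) (f v : Plane → ℝ) : ℝ :=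
  (∫ x in U, f x * v x) - ∫ x in U, contractHess τ v x

lemma defect_add {U : Set Plane} {τ : Plane → Matrix (Fin 2) (Fin 2) ℝ}
    (hτ : ∀ i j, MemLp (fun x => τ x i j) 2 (volume.restrict U)) {f u v : Plane → ℝ}
    (hf : MemLp f 2 (volume.restrict U))
    (hu : ContDiff ℝ ∞ u) (huc : HasCompactSupport u)
    (hv : ContDiff ℝ ∞ v) (hvc : HasCompactSupport v) :
    defect U τ f (u + v) = defect U τ f u + defect U τ f v := by
  have e1 : ∀ x, f x * (u + v) x = f x * u x + f x * v x := fun x => by simp [mul_add]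
  have e2 : ∀ x, contractHess τ (u + v) x = contractHess τ u x + contractHess τ v x := by
    intro x
    simp [contractHess, pderiv_pderiv_add hu hv, mul_add, Finset.sum_add_distrib]
  simp only [defect, e1, e2]
  rw [integral_add (integrableOn_mul hf hu huc) (integrableOn_mul hf hv hvc),
    integral_add (integrableOn_contractHess hτ hu huc) (integrableOn_contractHess hτ hv hvc)]
  ring

lemma defect_eq_zero_of_disjoint {U : Set Plane}
    (τ : Plane → Matrix (Fin 2) (Fin 2) ℝ) (f : Plane → ℝ) {v : Plane → ℝ}
    (h : Disjoint (tsupport v) U) : defect U τ f v = 0 := by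
  have hn : ∀ x ∈ U, x ∉ tsupport v := fun x hx hx' => h.le_bot ⟨hx', hx⟩
  rw [defect, setIntegral_eq_zero_of_forall_eq_zero, setIntegral_eq_zero_of_forall_eq_zero,
    sub_zero]
  · exact fun x hx => contractHess_eq_zero (hn x hx) τ
  · exact fun x hx => by rw [image_eq_zero_of_notMem_tsupport (hn x hx), mul_zero]

/-- Localization: an additive property of test functions that holds for functions with small
supports holds for all of them. -/
lemma test_induction {P : (Plane → ℝ) → Prop} {U : Set Plane} (h0 : P 0)
    (hadd : ∀ u v : Plane → ℝ, ContDiff ℝ ∞ u → HasCompactSupport u → ContDiff ℝ ∞ v →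
      HasCompactSupport v → P u → P v → P (u + v))
    (hloc : ∀ x ∈ U, ∃ r > 0, ∀ v : Plane → ℝ, ContDiff ℝ ∞ v → HasCompactSupport v →
      tsupport v ⊆ Metric.ball x r → P v)
    {v : Plane → ℝ} (hv : ContDiff ℝ ∞ v) (hc : HasCompactSupport v) (hvU : tsupport v ⊆ U) :
    P v := by
  choose! r hr hP using hloc
  -- The cover uses a third of each radius, so a bump equal to 1 on the small ball can still have
  -- its support in the large one.
  obtain ⟨s, hs, hcov⟩ := hc.isCompact.elim_nhds_subcover (fun x => Metric.ball x (r x / 3))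
    (fun x hx => Metric.ball_mem_nhds x (by linarith [hr x (hvU hx)]))
  replace hs : ∀ x ∈ s, x ∈ U := fun x hx => hvU (hs x hx)
  clear hvU
  induction s using Finset.induction_on generalizing v with
  | empty =>
    have : v = 0 := by
      rw [← tsupport_eq_empty_iff]
      simpa using hcov
    rw [this]; exact h0
  | insert a s ha ih =>
    have hra := hr a (hs a (by simp))
    let φ : ContDiffBump a := ⟨r a / 3, r a / 2, by linarith, by linarith⟩
    have hφ : ContDiff ℝ ∞ (φ : Plane → ℝ) := φ.contDiff
    have hφ' : ContDiff ℝ ∞ (1 - φ : Plane → ℝ) := contDiff_const.sub hφ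
    -- The first summand is local at `a`; the second vanishes on the ball around `a`, so the
    -- remaining balls cover its support.
    have e : v = v * φ + v * (1 - φ) := by ring
    have hsub : tsupport (v * (1 - φ) : Plane → ℝ) ⊆ tsupport v := tsupport_mul_subset_left
    rw [e]
    refine hadd _ _ (hv.mul hφ) hc.mul_right (hv.mul hφ') hc.mul_right ?_ ?_
    · refine hP a (hs a (by simp)) _ (hv.mul hφ) hc.mul_right ?_
      refine (tsupport_mul_subset_right).trans ?_
      rw [φ.tsupport_eq]
      exact Metric.closedBall_subset_ball (by change r a / 2 < r a; linarith)
    · refine ih (hv.mul hφ') hc.mul_right ?_ fun x hx => hs x (by simp [hx])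
      intro x hx
      have h1 := hcov (hsub hx)
      simp only [Finset.mem_insert, iUnion_iUnion_eq_or_left, mem_union] at h1
      refine h1.resolve_left fun hxa => ?_
      refine (closure_minimal (s := Function.support (v * (1 - φ) : Plane → ℝ))
        (t := (Metric.ball a (r a / 3))ᶜ) ?_ Metric.isOpen_ball.isClosed_compl hx) hxa
      intro y hy hya
      refine hy ?_
      have : φ y = 1 := φ.one_of_mem_closedBall (Metric.ball_subset_closedBall hya)
      simp [this]

/-! ### Segments -/

lemma rightNormal_swap (a b : Plane) : rightNormal b a = -rightNormal a b := by
  ext i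
  fin_cases i <;> simp [rightNormal, norm_sub_rev a b] <;> ring

lemma inner_sub_rightNormal (a b : Plane) : inner ℝ (b - a) (rightNormal a b) = 0 := by
  simp [rightNormal, inner_smul_right, PiLp.inner_apply, Fin.sum_univ_two]
  right; ring

lemma inner_rightNormal_self {a b : Plane} (h : a ≠ b) :
    inner ℝ (rightNormal a b) (rightNormal a b) = (1 : ℝ) := by
  have h0 : ‖b - a‖ ≠ 0 := norm_ne_zero_iff.2 (sub_ne_zero.2 h.symm)
  have h1 : ‖b - a‖ ^ 2 = (b - a) 0 ^ 2 + (b - a) 1 ^ 2 := by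
    rw [EuclideanSpace.norm_sq_eq]; simp [Fin.sum_univ_two]
  rw [rightNormal, inner_smul_left, inner_smul_right]
  have h2 : inner ℝ !₂[(b - a) 1, -((b - a) 0)] !₂[(b - a) 1, -((b - a) 0)] = ‖b - a‖ ^ 2 := by
    rw [h1, PiLp.inner_apply, Fin.sum_univ_two]
    simp only [RCLike.inner_apply, conj_trivial, Matrix.cons_val_zero, Matrix.cons_val_one]
    ring
  rw [h2, conj_trivial]
  field_simp

lemma inner_sub_rightNormal_of_mem {a b x y : Plane} (hx : x ∈ segment ℝ a b)
    (hy : y ∈ segment ℝ a b) : inner ℝ (y - x) (rightNormal a b) = 0 := by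
  rw [segment_eq_image'] at hx hy
  obtain ⟨s, -, rfl⟩ := hx
  obtain ⟨t, -, rfl⟩ := hy
  have : a + t • (b - a) - (a + s • (b - a)) = (t - s) • (b - a) := by module
  rw [this, inner_smul_left, inner_sub_rightNormal, mul_zero]

/-- The reflection `s ↦ 1 - s` preserves Lebesgue measure on `[0, 1]`. -/
lemma arcLength_comm (a b : Plane) : arcLength b a = arcLength a b := by
  have h1 : MeasurePreserving (fun s : ℝ => 1 - s) := volume.measurePreserving_sub_left 1
  have h2 := (h1.restrict_preimage (measurableSet_Icc (a := (0 : ℝ)) (b := 1))).map_eq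
  have h3 : (fun s : ℝ => 1 - s) ⁻¹' Icc 0 1 = Icc 0 1 := by
    ext s
    simp only [mem_preimage, mem_Icc]
    constructor <;> rintro ⟨h, h'⟩ <;> constructor <;> linarith
  rw [h3] at h2
  have hm : Measurable (fun s : ℝ => AffineMap.lineMap (k := ℝ) b a s) :=
    AffineMap.lineMap_continuous.measurable
  rw [arcLength, arcLength, dist_comm b a]
  congr 1
  rw [← h2, Measure.map_map hm h1.measurable, h2]
  congr 1
  ext s : 1
  simp [AffineMap.lineMap_apply_one_sub]

/-- In the parameter of `[a, b]`, the numbers 0 and 1 are convex combinations of the parameters `s,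
t ∈ [0, 1]` of `c` and `d`, which forces `{s, t} = {0, 1}`. -/
lemma eq_or_eq_of_segment_eq {a b c d : Plane} (hab : a ≠ b)
    (h : segment ℝ c d = segment ℝ a b) : (c = a ∧ d = b) ∨ (c = b ∧ d = a) := by
  have hc : c ∈ segment ℝ a b := h ▸ left_mem_segment ℝ c d
  have hd : d ∈ segment ℝ a b := h ▸ right_mem_segment ℝ c d
  have ha : a ∈ segment ℝ c d := h ▸ left_mem_segment ℝ a b
  have hb : b ∈ segment ℝ c d := h ▸ right_mem_segment ℝ a b
  rw [segment_eq_image'] at hc hd ha hb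
  obtain ⟨s, ⟨hs0, hs1⟩, rfl⟩ := hc
  obtain ⟨t, ⟨ht0, ht1⟩, rfl⟩ := hd
  obtain ⟨p, ⟨hp0, hp1⟩, hp⟩ := ha
  obtain ⟨q, ⟨hq0, hq1⟩, hq⟩ := hb
  beta_reduce at hp hq
  have hne : b - a ≠ 0 := sub_ne_zero.2 hab.symm
  have e1 : (s + p * (t - s)) • (b - a) = (0 : ℝ) • (b - a) := by
    have : (s + p * (t - s)) • (b - a)
      = a + s • (b - a) + p • (a + t • (b - a) - (a + s • (b - a))) - a := by module
    rw [this, hp]; simp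
  have e2 : (s + q * (t - s)) • (b - a) = (1 : ℝ) • (b - a) := by
    have : (s + q * (t - s)) • (b - a)
      = a + s • (b - a) + q • (a + t • (b - a) - (a + s • (b - a))) - a := by module
    rw [this, hq]; simp
  replace e1 := smul_left_injective ℝ hne e1
  replace e2 := smul_left_injective ℝ hne e2
  rcases le_total s t with hst | hst
  · have hs : s = 0 := by nlinarith
    have ht : t = 1 := by nlinarith
    left; subst hs ht; simp
  · have hs : s = 1 := by nlinarith
    have ht : t = 0 := by nlinarith
    right; subst hs ht; simp

lemma volume_segment (a b : Plane) : volume (segment ℝ a b) = 0 := by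
  refine measure_mono_null (t := (affineSpan ℝ {a, b} : Set Plane)) ?_ ?_
  · rw [← convexHull_pair]; exact convexHull_subset_affineSpan _
  · refine Measure.addHaar_affineSubspace _ _ fun h => ?_
    have h1 := (collinear_pair ℝ a b).finrank_le_one
    rw [← direction_affineSpan, h, AffineSubspace.direction_top, finrank_top] at h1
    simp at h1

lemma isClosed_segment' (a b : Plane) : IsClosed (segment ℝ a b) := by
  rw [segment_eq_image_lineMap]
  exact (isCompact_Icc.image AffineMap.lineMap_continuous).isClosed

/-- Away from the frontier, the plane is the disjoint union of the open sets `U` and `(closure U)ᶜ`.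
-/
lemma subset_of_disjoint_frontier {S U : Set Plane} (hS : IsPreconnected S) (hU : IsOpen U)
    (h : Disjoint S (frontier U)) (hne : (S ∩ U).Nonempty) : S ⊆ U := by
  refine hS.subset_left_of_subset_union hU isClosed_closure.isOpen_compl
    (disjoint_compl_right.mono_left subset_closure) (fun x hx => ?_) hne
  by_contra hc
  simp only [mem_union, mem_compl_iff, not_or, not_not] at hc
  refine h.le_bot ⟨hx, ?_⟩
  rw [frontier, hU.interior_eq]
  exact ⟨hc.2, hc.1⟩

lemma disjoint_of_disjoint_frontier {S U : Set Plane} (hS : IsPreconnected S) (hU : IsOpen U)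
    (h : Disjoint S (frontier U)) (hne : (S ∩ Uᶜ).Nonempty) : Disjoint S U := by
  rw [Set.disjoint_iff_inter_eq_empty, ← Set.not_nonempty_iff_eq_empty]
  intro h'
  obtain ⟨x, hx, hx'⟩ := hne
  exact hx' (subset_of_disjoint_frontier hS hU h h' hx)

/-! ### Polygons -/

namespace SimplePolygon

variable (K : SimplePolygon)

instance : NeZero K.n := ⟨by have := K.three_le; omega⟩

lemma vertex_ne (k : ZMod K.n) : K.vertex k ≠ K.vertex (k + 1) := by
  have : Fact (1 < K.n) := ⟨by have := K.three_le; omega⟩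
  intro h
  simpa using K.vertex_injective h

lemma inner_normal_self (k : ZMod K.n) : inner ℝ (K.normal k) (K.normal k) = (1 : ℝ) :=
  inner_rightNormal_self (K.vertex_ne k)

lemma edge_subset_frontier (k : ZMod K.n) : K.edge k ⊆ frontier K.inside := by
  rw [K.frontier_inside]
  exact subset_iUnion (fun k => segment ℝ (K.vertex k) (K.vertex (k + 1))) k

lemma exists_mem_edge {x : Plane} (hx : x ∈ frontier K.inside) : ∃ k, x ∈ K.edge k := by
  rw [K.frontier_inside] at hx
  exact mem_iUnion.1 hx

lemma vertex_mem_frontier (k : ZMod K.n) : K.vertex k ∈ frontier K.inside :=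
  K.edge_subset_frontier k (left_mem_segment ℝ _ _)

lemma openEdge_subset_edge (k : ZMod K.n) : K.openEdge k ⊆ K.edge k :=
  openSegment_subset_segment ℝ _ _

lemma mem_vertex_or_openEdge {x : Plane} {k : ZMod K.n} (hx : x ∈ K.edge k) :
    (∃ l, x = K.vertex l) ∨ x ∈ K.openEdge k := by
  rw [edge, ← insert_endpoints_openSegment] at hx
  rcases hx with h | h | h
  · exact .inl ⟨_, h⟩
  · exact .inl ⟨_, h⟩
  · exact .inr h

lemma volume_frontier : volume (frontier K.inside) = 0 := by
  rw [K.frontier_inside]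
  exact measure_iUnion_null fun k => volume_segment _ _

/-- Near an interior point of an edge the polygon is a half-disc. -/
lemma exists_half_ball {k : ZMod K.n} {x : Plane} (hx : x ∈ K.openEdge k) :
    ∃ R > 0, (∀ l, l ≠ k → Disjoint (Metric.ball x R) (K.edge l)) ∧
      ∀ y ∈ Metric.ball x R, (inner ℝ (y - x) (K.normal k) < 0 → y ∈ K.inside) ∧
        (0 < inner ℝ (y - x) (K.normal k) → y ∉ closure K.inside) := by
  have hcl : IsClosed (⋃ l ∈ {l | l ≠ k}, K.edge l) :=
    (Set.toFinite _).isClosed_biUnion fun l _ => isClosed_segment' _ _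
  have hxn : x ∉ ⋃ l ∈ {l | l ≠ k}, K.edge l := by
    simp only [mem_iUnion, not_exists]
    exact fun l hl hxl => (K.edges_simple k l (Ne.symm hl)).le_bot ⟨hx, hxl⟩
  obtain ⟨R, hR, hb⟩ := Metric.isOpen_iff.1 hcl.isOpen_compl x hxn
  have hdisj : ∀ l, l ≠ k → Disjoint (Metric.ball x R) (K.edge l) := by
    intro l hl
    rw [Set.disjoint_left]
    intro y hy hyl
    exact hb hy (mem_biUnion (show l ∈ {l | l ≠ k} from hl) hyl)
  have hfr : ∀ y ∈ Metric.ball x R, y ∈ frontier K.inside →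
      inner ℝ (y - x) (K.normal k) = 0 := by
    intro y hy hyf
    obtain ⟨l, hl⟩ := K.exists_mem_edge hyf
    by_cases hlk : l = k
    · subst hlk
      exact inner_sub_rightNormal_of_mem (K.openEdge_subset_edge l hx) hl
    · exact ((hdisj l hlk).le_bot ⟨hy, hl⟩).elim
  have hlin : IsLinearMap ℝ fun y : Plane => inner ℝ y (K.normal k) :=
    ⟨fun _ _ => inner_add_left _ _ _, fun _ _ => by simp [inner_smul_left]⟩
  have hrw : ∀ y, inner ℝ (y - x) (K.normal k) = inner ℝ y (K.normal k) - inner ℝ x (K.normal k) :=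
    fun y => inner_sub_left _ _ _
  -- Both open half-discs are convex and miss the frontier, so each lies entirely inside or entirely
  -- outside; `counterclockwise` supplies one point of each to decide which.
  have hneg : Convex ℝ (Metric.ball x R ∩ {y | inner ℝ y (K.normal k) < inner ℝ x (K.normal k)}) :=
    (convex_ball x R).inter (convex_halfSpace_lt hlin _)
  have hpos : Convex ℝ (Metric.ball x R ∩ {y | inner ℝ x (K.normal k) < inner ℝ y (K.normal k)}) :=
    (convex_ball x R).inter (convex_halfSpace_gt hlin _)
  obtain ⟨s, ⟨hs1, hs2⟩, hs0, hsR⟩ :=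
    ((K.counterclockwise k x hx).and (Ioo_mem_nhdsGT hR)).exists
  have hnn : ‖K.normal k‖ = 1 := by
    have := K.inner_normal_self k
    rw [real_inner_self_eq_norm_sq] at this
    nlinarith [norm_nonneg (K.normal k)]
  refine ⟨R, hR, hdisj, fun y hy => ⟨fun h => ?_, fun h => ?_⟩⟩
  · refine subset_of_disjoint_frontier hneg.isPreconnected K.isOpen_inside ?_
      ⟨x - s • K.normal k, ⟨?_, ?_⟩, hs1⟩ ⟨hy, by simpa [hrw] using h⟩
    · rw [Set.disjoint_left]
      rintro z ⟨hz, hz'⟩ hzf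
      have h1 := hfr z hz hzf
      rw [hrw] at h1
      simp only [mem_ofPred_eq] at hz'
      linarith
    · simpa [norm_smul, hnn, abs_of_pos hs0] using hsR
    · simp [inner_sub_left, inner_smul_left, hnn, hs0]
  · have hd := disjoint_of_disjoint_frontier hpos.isPreconnected K.isOpen_inside ?_
      ⟨x + s • K.normal k, ⟨?_, ?_⟩, hs2⟩
    · intro hyc
      have hopen : IsOpen (Metric.ball x R ∩
          {y | inner ℝ x (K.normal k) < inner ℝ y (K.normal k)}) :=
        Metric.isOpen_ball.inter (isOpen_lt continuous_const (by fun_prop))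
      exact (hd.closure_right hopen).le_bot ⟨⟨hy, by simpa [hrw] using h⟩, hyc⟩
    · rw [Set.disjoint_left]
      rintro z ⟨hz, hz'⟩ hzf
      have h1 := hfr z hz hzf
      rw [hrw] at h1
      simp only [mem_ofPred_eq] at hz'
      linarith
    · simpa [norm_smul, hnn, abs_of_pos hs0] using hsR
    · simp [inner_add_left, inner_smul_left, hnn, hs0]

end SimplePolygon

/-! ### Meshes near edges -/

namespace IsPolygonalMesh

variable {ι : Type*} {Ω : Set Plane} {T : ι → SimplePolygon} (hT : IsPolygonalMesh Ω T)

include hT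

lemma isOpen : IsOpen Ω := hT.fills ▸ isOpen_interior

lemma inside_subset (i : ι) : (T i).inside ⊆ Ω := by
  rw [hT.fills]
  exact interior_maximal (subset_closure.trans (subset_iUnion (fun i => closure (T i).inside) i))
    (T i).isOpen_inside

lemma notMem_inside {i j : ι} (hij : i ≠ j) {x : Plane} (hx : x ∈ closure (T i).inside) :
    x ∉ (T j).inside := fun h =>
  ((hT.disjoint i j hij).closure_left (T j).isOpen_inside).le_bot ⟨hx, h⟩

lemma mem_frontier {i j : ι} (hij : i ≠ j) {x : Plane} (hx : x ∈ closure (T i).inside)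
    (hx' : x ∈ closure (T j).inside) : x ∈ frontier (T j).inside := by
  rw [frontier, (T j).isOpen_inside.interior_eq]
  exact ⟨hx', hT.notMem_inside hij hx⟩

lemma mem_closure {x : Plane} (hx : x ∈ Ω) : ∃ i, x ∈ closure (T i).inside := by
  rw [hT.fills] at hx
  exact mem_iUnion.1 (interior_subset hx)

lemma mem_cases {x : Plane} (hx : x ∈ Ω) : (∃ i, x ∈ (T i).inside) ∨
    (∃ i k, x ∈ (T i).openEdge k) ∨ ∃ i k, x = (T i).vertex k := by
  obtain ⟨i, hi⟩ := hT.mem_closure hx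
  by_cases hin : x ∈ (T i).inside
  · exact .inl ⟨i, hin⟩
  · have hf : x ∈ frontier (T i).inside := by
      rw [frontier, (T i).isOpen_inside.interior_eq]; exact ⟨hi, hin⟩
    obtain ⟨k, hk⟩ := (T i).exists_mem_edge hf
    rcases (T i).mem_vertex_or_openEdge hk with ⟨l, hl⟩ | h
    · exact .inr (.inr ⟨i, l, hl⟩)
    · exact .inr (.inl ⟨i, k, h⟩)

/-- Two cells traversing an edge in the same direction both contain the points just to the left of
its midpoint, so they overlap. -/
lemma eq_of_same_edge {i j : ι} {k : ZMod (T i).n} {l : ZMod (T j).n}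
    (h1 : (T j).vertex l = (T i).vertex k) (h2 : (T j).vertex (l + 1) = (T i).vertex (k + 1)) :
    i = j := by
  by_contra hij
  have hx : AffineMap.lineMap ((T i).vertex k) ((T i).vertex (k + 1)) (1 / 2 : ℝ) ∈
      openSegment ℝ ((T i).vertex k) ((T i).vertex (k + 1)) :=
    lineMap_mem_openSegment ℝ _ _ ⟨by norm_num, by norm_num⟩
  have e1 := (T i).counterclockwise k _ hx
  have e2 := (T j).counterclockwise l _ (by rw [h1, h2]; exact hx)
  rw [h1, h2] at e2
  obtain ⟨s, hs, hs'⟩ := (e1.and e2).exists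
  exact (hT.disjoint i j hij).le_bot ⟨hs.1, hs'.1⟩

lemma exists_reversed_edge {i j : ι} (hij : i ≠ j) {k : ZMod (T i).n} {x : Plane}
    (hx : x ∈ (T i).openEdge k) (hxj : x ∈ closure (T j).inside) :
    ∃ l, (T j).vertex l = (T i).vertex (k + 1) ∧ (T j).vertex (l + 1) = (T i).vertex k := by
  have hxe := (T i).openEdge_subset_edge k hx
  have hxi := frontier_subset_closure ((T i).edge_subset_frontier k hxe)
  obtain ⟨l, hl⟩ := (T j).exists_mem_edge (hT.mem_frontier hij hxi hxj)
  rcases hT.conforming i j hij k l with h | h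
  · rcases eq_or_eq_of_segment_eq ((T i).vertex_ne k) h.symm with h' | h'
    · exact (hij (hT.eq_of_same_edge h'.1 h'.2)).elim
    · exact ⟨l, h'⟩
  · exact (h.le_bot ⟨hx, hl⟩).elim

/-- An edge through an interior point of the domain belongs to exactly two cells, with opposite
orientations. -/
lemma exists_neighbour {i : ι} {k : ZMod (T i).n} {x : Plane} (hx : x ∈ (T i).openEdge k)
    (hxΩ : x ∈ Ω) : ∃ j, j ≠ i ∧ ∃ l, (T j).vertex l = (T i).vertex (k + 1) ∧
      (T j).vertex (l + 1) = (T i).vertex k ∧ ∀ m, x ∈ closure (T m).inside → m = i ∨ m = j := by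
  have := hT.finite
  have hex : ∃ j, j ≠ i ∧ x ∈ closure (T j).inside := by
    -- If no other cell touched `x`, the points `x + s n` with small `s > 0` would lie in `Ω` but in
    -- no closed cell.
    by_contra! hno
    have hcl : IsClosed (⋃ j ∈ {j | j ≠ i}, closure (T j).inside) :=
      (Set.toFinite _).isClosed_biUnion fun _ _ => isClosed_closure
    have hxn : x ∉ ⋃ j ∈ {j | j ≠ i}, closure (T j).inside := by
      simp only [mem_iUnion, not_exists]
      exact hno
    obtain ⟨R, hR, -, hb⟩ := (T i).exists_half_ball hx
    have ht : Tendsto (fun s : ℝ => x + s • (T i).normal k) (𝓝[>] 0) (𝓝 x) := by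
      have h0 : Continuous fun s : ℝ => x + s • (T i).normal k := by fun_prop
      simpa using (h0.tendsto 0).mono_left nhdsWithin_le_nhds
    obtain ⟨s, ⟨⟨hs1, hs2⟩, hs3⟩, hs0⟩ :=
      (((ht.eventually (hcl.isOpen_compl.mem_nhds hxn)).and
        (ht.eventually (hT.isOpen.mem_nhds hxΩ))).and
        (ht.eventually (Metric.ball_mem_nhds x hR))).and self_mem_nhdsWithin |>.exists
    obtain ⟨j, hj⟩ := hT.mem_closure hs2
    by_cases hji : j = i
    · subst hji
      refine (hb _ hs3).2 ?_ hj
      simp only [add_sub_cancel_left, inner_smul_left, (T j).inner_normal_self, conj_trivial,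
        mul_one]
      exact hs0
    · exact hs1 (mem_biUnion (show j ∈ {j | j ≠ i} from hji) hj)
  obtain ⟨j, hji, hj⟩ := hex
  obtain ⟨l, hl1, hl2⟩ := hT.exists_reversed_edge hji.symm hx hj
  refine ⟨j, hji, l, hl1, hl2, fun m hm => ?_⟩
  -- A third cell would also reverse the edge, hence traverse it in the same direction as `j`.
  by_contra! hmm
  obtain ⟨l', hl1', hl2'⟩ := hT.exists_reversed_edge hmm.1.symm hx hm
  exact hmm.2 (hT.eq_of_same_edge (hl1.trans hl1'.symm) (hl2.trans hl2'.symm))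

/-- The trace hypotheses require a whole open edge in `Ω`, whereas localization supplies a single
point. The two cells sharing the edge fill opposite half-discs around each of its relative interior
points. -/
lemma openEdge_subset {i : ι} {k : ZMod (T i).n} {x : Plane} (hx : x ∈ (T i).openEdge k)
    (hxΩ : x ∈ Ω) : (T i).openEdge k ⊆ Ω := by
  obtain ⟨j, -, l, hl1, hl2, -⟩ := hT.exists_neighbour hx hxΩ
  intro y hy
  have hy' : y ∈ (T j).openEdge l := by
    rw [SimplePolygon.openEdge, hl1, hl2, openSegment_symm]; exact hy
  have hn : (T j).normal l = -(T i).normal k := by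
    rw [SimplePolygon.normal, hl1, hl2, rightNormal_swap, SimplePolygon.normal]
  obtain ⟨R, hR, -, hb⟩ := (T i).exists_half_ball hy
  obtain ⟨R', hR', -, hb'⟩ := (T j).exists_half_ball hy'
  rw [hT.fills]
  refine mem_interior.2 ⟨Metric.ball y (min R R'), fun z hz => ?_, Metric.isOpen_ball,
    Metric.mem_ball_self (lt_min hR hR')⟩
  have hz1 : z ∈ Metric.ball y R := Metric.ball_subset_ball (min_le_left _ _) hz
  have hz2 : z ∈ Metric.ball y R' := Metric.ball_subset_ball (min_le_right _ _) hz
  rcases lt_trichotomy (inner ℝ (z - y) ((T i).normal k)) 0 with h | h | h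
  · exact mem_iUnion.2 ⟨i, subset_closure ((hb z hz1).1 h)⟩
  · refine mem_iUnion.2 ⟨i, ?_⟩
    have h0 : Continuous fun s : ℝ => z - s • (T i).normal k := by fun_prop
    have ht : Tendsto (fun s : ℝ => z - s • (T i).normal k) (𝓝[>] 0) (𝓝 z) := by
      simpa using (h0.tendsto 0).mono_left nhdsWithin_le_nhds
    refine mem_closure_of_tendsto ht ?_
    filter_upwards [ht.eventually (Metric.isOpen_ball.mem_nhds hz1), self_mem_nhdsWithin]
      with s hs hs0
    refine (hb _ hs).1 ?_
    rw [sub_right_comm, inner_sub_left, h, inner_smul_left, (T i).inner_normal_self]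
    simpa using hs0
  · refine mem_iUnion.2 ⟨j, subset_closure ((hb' z hz2).1 ?_)⟩
    rw [hn, inner_neg_right]; linarith

end IsPolygonalMesh

/-! ### Traces on an edge -/

lemma dirDeriv_eq_zero {v : Plane → ℝ} {x : Plane} (hx : x ∉ tsupport v) (ν : Plane) :
    dirDeriv ν v x = 0 := by
  rw [dirDeriv, fderiv_of_notMem_tsupport ℝ hx]; simp

lemma support_subset_tsupport_subset_ball {v : Plane → ℝ} {x : Plane} {r R : ℝ} (hrR : r < R)
    (h : ∀ z, v z ≠ 0 → dist z x ≤ r) : tsupport v ⊆ Metric.ball x R ∧ HasCompactSupport v := by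
  have h' : Function.support v ⊆ Metric.closedBall x r := fun z hz => h z hz
  exact ⟨(closure_minimal h' Metric.isClosed_closedBall).trans
      (Metric.closedBall_subset_ball hrR),
    HasCompactSupport.of_support_subset_isCompact (isCompact_closedBall x r) h'⟩

/-- Near a segment, a test function is the sum of a function that vanishes on the segment and of
one whose normal derivative vanishes there. -/
lemma exists_trace_splitting {a b x : Plane} (hab : a ≠ b) (hx : x ∈ segment ℝ a b) {R : ℝ}
    (hR : 0 < R) {v : Plane → ℝ} (hv : ContDiff ℝ ∞ v)
    (hvR : tsupport v ⊆ Metric.ball x (R / 4)) :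
    ∃ v₁ v₂ : Plane → ℝ, v = v₁ + v₂ ∧ ContDiff ℝ ∞ v₁ ∧ ContDiff ℝ ∞ v₂ ∧
      (HasCompactSupport v₁ ∧ HasCompactSupport v₂) ∧
      tsupport v₁ ⊆ Metric.ball x R ∧ tsupport v₂ ⊆ Metric.ball x R ∧
      (∀ z ∈ segment ℝ a b, v₁ z = 0) ∧
      ∀ z ∈ segment ℝ a b, dirDeriv (rightNormal a b) v₂ z = 0 := by
  set n := rightNormal a b
  have hnn : inner ℝ n n = (1 : ℝ) := inner_rightNormal_self hab
  have hnorm : ‖n‖ = 1 := by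
    rw [real_inner_self_eq_norm_sq] at hnn
    nlinarith [norm_nonneg n]
  have hz0 : ∀ z ∈ segment ℝ a b, inner ℝ (z - x) n = 0 := fun z hz =>
    inner_sub_rightNormal_of_mem hx hz
  let χ : ContDiffBump (0 : ℝ) := ⟨R / 8, R / 4, by linarith, by linarith⟩
  -- `v` at the foot of the perpendicular, cut off in the normal coordinate: near the line, `v₂` is
  -- constant along normals. Foot and normal offset each contribute at most `R / 4`, so the support
  -- stays within `R / 2` of `x`.
  let v₂ : Plane → ℝ := fun z => v (z - inner ℝ (z - x) n • n) * χ (inner ℝ (z - x) n)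
  have hv2 : ContDiff ℝ ∞ v₂ := by
    have hp : ContDiff ℝ ∞ fun z : Plane => inner ℝ (z - x) n :=
      (contDiff_id.sub contDiff_const).inner ℝ contDiff_const
    exact (hv.comp (contDiff_id.sub (hp.smul contDiff_const))).mul (χ.contDiff.comp hp)
  have hχ0 : χ 0 = 1 := χ.eventuallyEq_one.self_of_nhds
  have hball : ∀ z, v z ≠ 0 → dist z x < R / 4 := fun z hz => hvR (subset_closure hz)
  have hsupp2 : ∀ z, v₂ z ≠ 0 → dist z x ≤ R / 2 := by
    intro z hz
    have h1 := hball _ (left_ne_zero_of_mul hz)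
    have h2 : |inner ℝ (z - x) n| < R / 4 := by
      by_contra! h
      exact right_ne_zero_of_mul hz (χ.zero_of_le_dist (by simpa using h))
    rw [dist_eq_norm] at h1 ⊢
    have e : z - x = (z - inner ℝ (z - x) n • n - x) + inner ℝ (z - x) n • n := by abel
    have h3 : ‖inner ℝ (z - x) n • n‖ = |inner ℝ (z - x) n| := by simp [norm_smul, hnorm]
    calc ‖z - x‖ ≤ ‖z - inner ℝ (z - x) n • n - x‖ + ‖inner ℝ (z - x) n • n‖ := by
          conv_lhs => rw [e]
          exact norm_add_le _ _
      _ ≤ R / 2 := by rw [h3]; linarith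
  have hsupp1 : ∀ z, (v - v₂) z ≠ 0 → dist z x ≤ R / 2 := by
    intro z hz
    by_contra! h
    have h1 : v z = 0 := by by_contra h'; linarith [hball z h']
    have h2 : v₂ z = 0 := by by_contra h'; linarith [hsupp2 z h']
    exact hz (by simp [h1, h2])
  obtain ⟨s1, c1⟩ := support_subset_tsupport_subset_ball (show R / 2 < R by linarith) hsupp1
  obtain ⟨s2, c2⟩ := support_subset_tsupport_subset_ball (show R / 2 < R by linarith) hsupp2
  refine ⟨v - v₂, v₂, by simp, hv.sub hv2, hv2, ⟨c1, c2⟩, s1, s2, fun z hz => ?_, fun z hz => ?_⟩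
  · simp [v₂, hz0 z hz, hχ0]
  · have hl : HasDerivAt (fun t : ℝ => z + t • n) n 0 := by
      simpa using ((hasDerivAt_id (0 : ℝ)).smul_const n).const_add z
    have h1 : HasFDerivAt v₂ (fderiv ℝ v₂ z) (z + (0 : ℝ) • n) := by
      simpa using (hv2.differentiable (by simp) z).hasFDerivAt
    have h2 := h1.comp_hasDerivAt (0 : ℝ) hl
    have h3 : (v₂ ∘ fun t : ℝ => z + t • n) =ᶠ[𝓝 0] fun _ => v z := by
      filter_upwards [χ.eventuallyEq_one] with t ht
      have e : inner ℝ (z + t • n - x) n = t := by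
        rw [add_sub_right_comm, inner_add_left, hz0 z hz, inner_smul_left, hnn]; simp
      simp [v₂, e, ht]
    exact h2.unique ((hasDerivAt_const (0 : ℝ) (v z)).congr_of_eventuallyEq h3)

section Traces

variable {K : SimplePolygon} {τ : Plane → Matrix (Fin 2) (Fin 2) ℝ} {f g : Plane → ℝ}
  {k : ZMod K.n} {x : Plane} {R : ℝ}

/-- Since the support meets no other edge, the side conditions there are automatic and only the
condition on edge `k` remains. -/
lemma HasNormalNormalTrace.defect_eq (h : HasNormalNormalTrace K τ k g)
    (hf : IsWeakDivDiv K.inside τ f)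
    (hR : ∀ l, l ≠ k → Disjoint (Metric.ball x R) (K.edge l)) {v : Plane → ℝ}
    (hv : ContDiff ℝ ∞ v) (hvR : tsupport v ⊆ Metric.ball x R) (h0 : ∀ z ∈ K.edge k, v z = 0) :
    defect K.inside τ f v = -∫ z, g z * dirDeriv (K.normal k) v z ∂(K.edgeMeasure k) := by
  have hn : ∀ l, l ≠ k → ∀ z ∈ K.edge l, z ∉ tsupport v := fun l hl z hz hz' =>
    (hR l hl).le_bot ⟨hvR hz', hz⟩
  rw [← h.2 f hf v hv ?_ fun l hl z hz => dirDeriv_eq_zero (hn l hl z hz) _, defect]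
  · ring
  · intro z hz
    obtain ⟨l, hl⟩ := K.exists_mem_edge hz
    by_cases hlk : l = k
    · subst hlk; exact h0 z hl
    · exact image_eq_zero_of_notMem_tsupport (hn l hlk z hl)

lemma HasShearTrace.defect_eq {ν : Plane} (h : HasShearTrace K τ k ν g)
    (hf : IsWeakDivDiv K.inside τ f)
    (hR : ∀ l, l ≠ k → Disjoint (Metric.ball x R) (K.edge l)) {v : Plane → ℝ}
    (hv : ContDiff ℝ ∞ v) (hvR : tsupport v ⊆ Metric.ball x R)
    (h0 : ∀ z ∈ K.edge k, dirDeriv (K.normal k) v z = 0) :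
    defect K.inside τ f v = inner ℝ (K.normal k) ν * ∫ z, g z * v z ∂(K.edgeMeasure k) := by
  have hn : ∀ l, l ≠ k → ∀ z ∈ K.edge l, z ∉ tsupport v := fun l hl z hz hz' =>
    (hR l hl).le_bot ⟨hvR hz', hz⟩
  rw [← h.2 f hf v hv ?_ fun l hl z hz => image_eq_zero_of_notMem_tsupport (hn l hl z hz), defect]
  intro l z hz
  by_cases hlk : l = k
  · subst hlk; exact h0 z hz
  · exact dirDeriv_eq_zero (hn l hlk z hz) _

end Traces

/-- If the traces are single-valued, the defects of the cells cancel near an interior edge. -/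
lemma sum_defect_eq_zero_near_edge {ι : Type*} [Fintype ι] {Ω : Set Plane}
    {T : ι → SimplePolygon} (hT : IsPolygonalMesh Ω T)
    {τ : Plane → Matrix (Fin 2) (Fin 2) ℝ} (hτ : MemL2Sym Ω τ) {f : Plane → ℝ}
    (hf : ∀ i, IsWeakDivDiv (T i).inside τ f)
    (h_normal : ∀ i (k : ZMod (T i).n), (T i).openEdge k ⊆ Ω →
      ∃ g : Plane → ℝ, ∀ j (l : ZMod (T j).n), (T j).edge l = (T i).edge k →
        HasNormalNormalTrace (T j) τ l g)
    (h_shear : ∀ i (k : ZMod (T i).n), (T i).openEdge k ⊆ Ω →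
      ∃ g : Plane → ℝ, ∀ j (l : ZMod (T j).n), (T j).edge l = (T i).edge k →
        HasShearTrace (T j) τ l ((T i).normal k) g)
    {i : ι} {k : ZMod (T i).n} {x : Plane} (hx : x ∈ (T i).openEdge k) (hxΩ : x ∈ Ω) :
    ∃ r > 0, ∀ v : Plane → ℝ, ContDiff ℝ ∞ v → HasCompactSupport v →
      tsupport v ⊆ Metric.ball x r → ∑ m, defect (T m).inside τ f v = 0 := by
  classical
  obtain ⟨j, hji, l, hl1, hl2, hm⟩ := hT.exists_neighbour hx hxΩ
  have hx' : x ∈ (T j).openEdge l := by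
    rw [SimplePolygon.openEdge, hl1, hl2, openSegment_symm]; exact hx
  have hn : (T j).normal l = -(T i).normal k := by
    rw [SimplePolygon.normal, hl1, hl2, rightNormal_swap, SimplePolygon.normal]
  have he : (T j).edge l = (T i).edge k := by
    rw [SimplePolygon.edge, hl1, hl2, segment_symm, SimplePolygon.edge]
  have hμ : (T j).edgeMeasure l = (T i).edgeMeasure k := by
    rw [SimplePolygon.edgeMeasure, hl1, hl2, arcLength_comm, SimplePolygon.edgeMeasure]
  obtain ⟨R₁, hR₁, hd₁, -⟩ := (T i).exists_half_ball hx
  obtain ⟨R₂, hR₂, hd₂, -⟩ := (T j).exists_half_ball hx'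
  have hcl : IsClosed (⋃ m ∈ {m | x ∉ closure (T m).inside}, closure (T m).inside) :=
    (Set.toFinite _).isClosed_biUnion fun _ _ => isClosed_closure
  have hxn : x ∉ ⋃ m ∈ {m | x ∉ closure (T m).inside}, closure (T m).inside := by
    simp only [mem_iUnion, not_exists]
    exact fun m hm hm' => hm hm'
  obtain ⟨R₃, hR₃, hb⟩ := Metric.isOpen_iff.1 hcl.isOpen_compl x hxn
  set R := min R₁ (min R₂ R₃)
  have hR : 0 < R := lt_min hR₁ (lt_min hR₂ hR₃)
  have hRd₁ : ∀ m, m ≠ k → Disjoint (Metric.ball x R) ((T i).edge m) := fun m hm =>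
    (hd₁ m hm).mono_left (Metric.ball_subset_ball (min_le_left _ _))
  have hRd₂ : ∀ m, m ≠ l → Disjoint (Metric.ball x R) ((T j).edge m) := fun m hm =>
    (hd₂ m hm).mono_left
      (Metric.ball_subset_ball ((min_le_right _ _).trans (min_le_left _ _)))
  have hRd₃ : ∀ m, m ≠ i ∧ m ≠ j → Disjoint (Metric.ball x R) (T m).inside := by
    intro m hmm
    rw [Set.disjoint_left]
    intro y hy hym
    have hxm : x ∉ closure (T m).inside := fun h => (hm m h).elim hmm.1 hmm.2
    exact hb (Metric.ball_subset_ball ((min_le_right _ _).trans (min_le_right _ _)) hy)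
      (mem_biUnion (show m ∈ {m | x ∉ closure (T m).inside} from hxm) (subset_closure hym))
  have hsub := hT.openEdge_subset hx hxΩ
  obtain ⟨g, hg⟩ := h_normal i k hsub
  obtain ⟨g', hg'⟩ := h_shear i k hsub
  refine ⟨R / 4, by linarith, fun v hv hvc hvR => ?_⟩
  obtain ⟨v₁, v₂, rfl, hv₁, hv₂, ⟨c₁, c₂⟩, s₁, s₂, z₁, z₂⟩ := exists_trace_splitting
    ((T i).vertex_ne k) ((T i).openEdge_subset_edge k hx) hR hv hvR
  have hτm : ∀ m a b, MemLp (fun x => τ x a b) 2 (volume.restrict (T m).inside) := fun m a b =>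
    (hτ.1 a b).mono_measure (Measure.restrict_mono (hT.inside_subset m) le_rfl)
  -- Both cells have the same `g` and the same arc length, while the normal derivative changes sign.
  have key₁ : ∑ m, defect (T m).inside τ f v₁ = 0 := by
    rw [Fintype.sum_eq_add i j hji.symm fun m hmm =>
      defect_eq_zero_of_disjoint τ f ((hRd₃ m hmm).mono_left s₁),
      (hg i k rfl).defect_eq (hf i) hRd₁ hv₁ s₁ z₁,
      (hg j l he).defect_eq (hf j) hRd₂ hv₁ s₁ (he ▸ z₁), hμ, hn]
    simp [dirDeriv, integral_neg]
  -- Here the factor `n_K · ν` changes sign, with `ν` the normal of cell `i`.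
  have key₂ : ∑ m, defect (T m).inside τ f v₂ = 0 := by
    rw [Fintype.sum_eq_add i j hji.symm fun m hmm =>
      defect_eq_zero_of_disjoint τ f ((hRd₃ m hmm).mono_left s₂),
      (hg' i k rfl).defect_eq (hf i) hRd₁ hv₂ s₂ z₂,
      (hg' j l he).defect_eq (hf j) hRd₂ hv₂ s₂ ?_, hμ, hn]
    · simp
    · intro z hz
      have := z₂ z (he.subset hz)
      rw [hn]
      simp only [dirDeriv, map_neg, neg_eq_zero] at this ⊢
      exact this
  simp only [defect_add (hτm _) (hf _).1 hv₁ c₁ hv₂ c₂, Finset.sum_add_distrib, key₁, key₂,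
    add_zero]

/-! ### Meshes near vertices -/

/-- For small `r` the average is over the empty set, where it is 0 by convention. This lets all
cells be treated alike at a vertex. -/
lemma hasValueAt_of_notMem_closure {K : SimplePolygon} {δ : Plane} (h : δ ∉ closure K.inside)
    (τ : Plane → Matrix (Fin 2) (Fin 2) ℝ) (A : Matrix (Fin 2) (Fin 2) ℝ) :
    HasValueAt K τ δ A := by
  intro i j
  obtain ⟨R, hR, hb⟩ := Metric.isOpen_iff.1 isClosed_closure.isOpen_compl δ h
  refine tendsto_const_nhds.congr' ?_
  filter_upwards [Ioo_mem_nhdsGT hR] with r hr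
  have : K.inside ∩ Metric.ball δ r = ∅ := by
    rw [← Set.not_nonempty_iff_eq_empty]
    rintro ⟨y, hy, hyr⟩
    exact hb (Metric.ball_subset_ball hr.2.le hyr) (subset_closure hy)
  simp [this]

lemma SimplePolygon.isFiniteMeasure_restrict (K : SimplePolygon) :
    IsFiniteMeasure ((volume : Measure Plane).restrict K.inside) :=
  MeasureTheory.isFiniteMeasure_restrict.2 K.isBounded_inside.measure_lt_top.ne

/-- The area of `K ∩ B_r(δ)` is at most `c r²`, with `c` the area of the unit disc, so the integral
is at most `c r²` times the average. -/
lemma HasValueAt.tendsto_integral {K : SimplePolygon} {δ : Plane}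
    {τ : Plane → Matrix (Fin 2) (Fin 2) ℝ} {A : Matrix (Fin 2) (Fin 2) ℝ}
    (h : HasValueAt K τ δ A) (i j : Fin 2) :
    Tendsto (fun r : ℝ => (r ^ 2)⁻¹ * ∫ x in K.inside ∩ Metric.ball δ r, |τ x i j - A i j|)
      (𝓝[>] 0) (𝓝 0) := by
  set c := (volume : Measure Plane).real (Metric.ball 0 1)
  have h0 := (h i j).const_mul c
  rw [mul_zero] at h0
  refine squeeze_zero' (.of_forall fun r => ?_) ?_ h0
  · positivity
  filter_upwards [self_mem_nhdsWithin] with r (hr : 0 < r)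
  have hfin : volume (Metric.ball δ r) ≠ ⊤ := Metric.isBounded_ball.measure_lt_top.ne
  have hfin' : volume (K.inside ∩ Metric.ball δ r) ≠ ⊤ :=
    measure_ne_top_of_subset inter_subset_right hfin
  rw [← measure_smul_setAverage _ hfin', smul_eq_mul, ← mul_assoc]
  have hb : (volume : Measure Plane).real (K.inside ∩ Metric.ball δ r) ≤ r ^ 2 * c := by
    refine (measureReal_mono inter_subset_right hfin).trans_eq ?_
    rw [measureReal_def, Measure.addHaar_ball _ _ hr.le, ENNReal.toReal_mul,
      ENNReal.toReal_ofReal (by positivity)]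
    simp [c, measureReal_def]
  have hav : 0 ≤ ⨍ x in K.inside ∩ Metric.ball δ r, |τ x i j - A i j| := by
    rw [setAverage_eq]; positivity
  refine mul_le_mul_of_nonneg_right ?_ hav
  rw [inv_mul_le_iff₀ (by positivity)]
  exact hb

lemma tsupport_rescale_subset {φ : Plane → ℝ} (hφ : tsupport φ ⊆ Metric.closedBall 0 (1 / 2))
    (δ : Plane) {r : ℝ} (hr : 0 < r) : tsupport (rescale φ δ r) ⊆ Metric.ball δ r := by
  refine (closure_minimal (t := Metric.closedBall δ (r / 2)) (fun x hx => ?_)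
    Metric.isClosed_closedBall).trans (Metric.closedBall_subset_ball (by linarith))
  have h1 : r⁻¹ • (x - δ) ∈ Metric.closedBall 0 (1 / 2) := hφ (subset_closure hx)
  rw [mem_closedBall_zero_iff, norm_smul, norm_inv, Real.norm_of_nonneg hr.le,
    inv_mul_le_iff₀ hr] at h1
  rw [Metric.mem_closedBall, dist_eq_norm]
  linarith

/-- At a vertex where `τ` has the value `A`, the cut-offs `v φ((x - δ) / r)` do not contribute to
the defect of `τ - A` in the limit `r → 0`. -/
lemma HasValueAt.tendsto_defect {K : SimplePolygon} {δ : Plane}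
    {τ : Plane → Matrix (Fin 2) (Fin 2) ℝ} {A : Matrix (Fin 2) (Fin 2) ℝ}
    (h : HasValueAt K τ δ A)
    (hτ : ∀ i j, MemLp (fun x => τ x i j) 2 (volume.restrict K.inside)) {f : Plane → ℝ}
    (hf : MemLp f 2 (volume.restrict K.inside)) {v φ : Plane → ℝ} (hv : ContDiff ℝ ∞ v)
    (hvc : HasCompactSupport v) (hφ : ContDiff ℝ ∞ φ) (hφc : HasCompactSupport φ)
    (hφs : tsupport φ ⊆ Metric.closedBall 0 (1 / 2)) :
    Tendsto (fun r : ℝ => defect K.inside (fun x => τ x - A) f (v * rescale φ δ r))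
      (𝓝[>] 0) (𝓝 0) := by
  have := K.isFiniteMeasure_restrict
  have hw : ∀ r, ContDiff ℝ ∞ (v * rescale φ δ r) := fun r => hv.mul (contDiff_rescale hφ δ r)
  have hwc : ∀ r, HasCompactSupport (v * rescale φ δ r) := fun r => hvc.mul_right
  have hws : ∀ r, 0 < r → tsupport (v * rescale φ δ r) ⊆ Metric.ball δ r := fun r hr =>
    (tsupport_mul_subset_right (f := v) (g := rescale φ δ r)).trans (tsupport_rescale_subset hφs δ hr)
  have hτA : ∀ i j, MemLp (fun x => τ x i j - A i j) 2 (volume.restrict K.inside) :=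
    fun i j => (hτ i j).sub (memLp_const _)
  have lim1 : Tendsto (fun r : ℝ => ∫ x in K.inside, f x * (v * rescale φ δ r) x)
      (𝓝[>] 0) (𝓝 0) := by
    obtain ⟨C, hC, hvC⟩ := exists_bound_of_test hv hvc
    obtain ⟨D, hD, hφD⟩ := exists_bound_of_test hφ hφc
    have hfi : Integrable f (volume.restrict K.inside) := hf.integrable (by norm_num)
    -- The cut-offs are bounded and tend to 0 at every point other than `δ`, a null set.
    have := tendsto_integral_filter_of_dominated_convergence (l := 𝓝[>] (0 : ℝ))
      (μ := volume.restrict K.inside) (F := fun r x => f x * (v * rescale φ δ r) x)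
      (f := fun _ => 0) (fun x => |f x| * (C * D)) ?_ ?_ (hfi.abs.mul_const _) ?_
    · simpa using this
    · exact .of_forall fun r => hf.1.mul (hw r).continuous.aestronglyMeasurable
    · refine .of_forall fun r => .of_forall fun x => ?_
      simp only [Pi.mul_apply, norm_mul, Real.norm_eq_abs]
      gcongr
      · exact hvC x
      · exact hφD _
    · have hne : ∀ᵐ x ∂(volume.restrict K.inside), x ≠ δ :=
        ae_restrict_of_ae (Measure.ae_ne volume δ)
      filter_upwards [hne] with x hx
      refine tendsto_const_nhds.congr' ?_
      filter_upwards [Ioo_mem_nhdsGT (dist_pos.2 hx)] with r hr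
      have hxs : x ∉ tsupport (v * rescale φ δ r) := fun hxs =>
        absurd (hws r hr.1 hxs) (by simpa using hr.2.le)
      rw [image_eq_zero_of_notMem_tsupport hxs, mul_zero]
  have lim2 : Tendsto (fun r : ℝ => ∫ x in K.inside,
      contractHess (fun x => τ x - A) (v * rescale φ δ r) x) (𝓝[>] 0) (𝓝 0) := by
    have e : ∀ r, ∫ x in K.inside, contractHess (fun x => τ x - A) (v * rescale φ δ r) x =
        ∑ i, ∑ j, ∫ x in K.inside,
          (τ x i j - A i j) * pderiv i (pderiv j (v * rescale φ δ r)) x := by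
      intro r
      have hint : ∀ i j, Integrable (fun x => (τ x i j - A i j) *
          pderiv i (pderiv j (v * rescale φ δ r)) x) (volume.restrict K.inside) := fun i j =>
        (hτA i j).integrable_mul (memLp_pderiv_pderiv (hw r) (hwc r) _ i j)
      simp only [contractHess, Matrix.sub_apply]
      rw [integral_finsetSum _ fun i _ => integrable_finsetSum _ fun j _ => hint i j]
      exact Finset.sum_congr rfl fun i _ => integral_finsetSum _ fun j _ => hint i j
    simp only [e]
    have z : 𝓝 (0 : ℝ) = 𝓝 (∑ _i : Fin 2, ∑ _j : Fin 2, 0) := by simp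
    rw [z]
    refine tendsto_finsetSum _ fun i _ => tendsto_finsetSum _ fun j _ => ?_
    obtain ⟨C, hC⟩ := exists_bound_pderiv_pderiv_mul_rescale hv hvc hφ hφc δ i j
    -- The factor `C r⁻²` from the Hessian is exactly what the `o(r²)` integral of `|τ - A|`
    -- absorbs.
    have h0 := (h.tendsto_integral i j).const_mul C
    rw [mul_zero] at h0
    refine squeeze_zero_norm' ?_ h0
    filter_upwards [Ioo_mem_nhdsGT (zero_lt_one' ℝ)] with r hr
    have hmeas := K.isOpen_inside.measurableSet
    have hres : ∫ x in K.inside, (τ x i j - A i j) *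
          pderiv i (pderiv j (v * rescale φ δ r)) x =
        ∫ x in K.inside ∩ Metric.ball δ r, (τ x i j - A i j) *
          pderiv i (pderiv j (v * rescale φ δ r)) x := by
      refine setIntegral_eq_of_subset_of_forall_sdiff_eq_zero hmeas inter_subset_left ?_
      rintro x ⟨hx, hxn⟩
      have hxs : x ∉ tsupport (pderiv i (pderiv j (v * rescale φ δ r))) := fun hxs =>
        hxn ⟨hx, hws r hr.1 (tsupport_pderiv_subset _ _ (tsupport_pderiv_subset _ _ hxs))⟩
      rw [image_eq_zero_of_notMem_tsupport hxs, mul_zero]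
    rw [hres, ← mul_assoc, ← integral_const_mul]
    refine norm_integral_le_of_norm_le ?_ (.of_forall fun x => ?_)
    · have h1 : IntegrableOn (fun x => τ x i j - A i j) K.inside :=
        (hτA i j).integrable (by norm_num)
      exact (h1.mono_set inter_subset_left).abs.const_mul _
    · rw [norm_mul, mul_comm, Real.norm_eq_abs, Real.norm_eq_abs]
      gcongr
      exact hC r hr.1 hr.2.le x
  simpa [defect] using lim1.sub lim2

lemma integral_contractHess_const {w : Plane → ℝ} (hw : ContDiff ℝ ∞ w)
    (hc : HasCompactSupport w) {U : Set Plane} (hU : tsupport w ⊆ U)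
    (A : Matrix (Fin 2) (Fin 2) ℝ) : ∫ x in U, contractHess (fun _ => A) w x = 0 := by
  rw [setIntegral_eq_integral_of_forall_compl_eq_zero fun x hx =>
    contractHess_eq_zero (fun h => hx (hU h)) _]
  have hint : ∀ i j, Integrable fun x => A i j * pderiv i (pderiv j w) x := fun i j =>
    ((contDiff_pderiv (contDiff_pderiv hw j) i).continuous.integrable_of_hasCompactSupport
      (hasCompactSupport_pderiv (hasCompactSupport_pderiv hc j) i)).const_mul _
  simp only [contractHess]
  rw [integral_finsetSum _ fun i _ => integrable_finsetSum _ fun j _ => hint i j]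
  refine Finset.sum_eq_zero fun i _ => ?_
  rw [integral_finsetSum _ fun j _ => hint i j]
  refine Finset.sum_eq_zero fun j _ => ?_
  rw [integral_const_mul, integral_pderiv_eq_zero (contDiff_pderiv hw j)
    (hasCompactSupport_pderiv hc j), mul_zero]

/-- `hA` expresses that `U` has finite measure, so that constant tensors are in `L²(U)`. -/
lemma defect_sub_const {U : Set Plane} {τ : Plane → Matrix (Fin 2) (Fin 2) ℝ}
    (hτ : ∀ i j, MemLp (fun x => τ x i j) 2 (volume.restrict U))
    {w : Plane → ℝ} (hw : ContDiff ℝ ∞ w) (hc : HasCompactSupport w) (f : Plane → ℝ)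
    (A : Matrix (Fin 2) (Fin 2) ℝ)
    (hA : MemLp (fun _ : Plane => (1 : ℝ)) 2 (volume.restrict U)) :
    defect U (fun x => τ x - A) f w =
      defect U τ f w + ∫ x in U, contractHess (fun _ => A) w x := by
  have e : ∀ x, contractHess (fun x => τ x - A) w x =
      contractHess τ w x - contractHess (fun _ => A) w x := by
    intro x; simp [contractHess, sub_mul]
  have hA' : ∀ i j, MemLp (fun _ : Plane => A i j) 2 (volume.restrict U) := fun i j => by
    simpa using hA.const_mul (A i j)
  simp only [defect, e]
  rw [integral_sub (integrableOn_contractHess hτ hw hc)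
    (integrableOn_contractHess (τ := fun _ => A) hA' hw hc)]
  ring

/-- The part of `Ω` outside the open cells lies on finitely many segments, a null set. -/
lemma IsPolygonalMesh.sum_integral {ι : Type*} [Fintype ι] {Ω : Set Plane}
    {T : ι → SimplePolygon} (hT : IsPolygonalMesh Ω T) {g : Plane → ℝ} (hg : IntegrableOn g Ω) :
    ∑ m, ∫ x in (T m).inside, g x = ∫ x in Ω, g x := by
  rw [← integral_iUnion_fintype (fun m => (T m).isOpen_inside.measurableSet)
    (fun i j hij => hT.disjoint i j hij) fun m => hg.mono_set (hT.inside_subset m)]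
  refine setIntegral_congr_set (LE.le.eventuallyLE
    (iUnion_subset hT.inside_subset) |>.antisymm ?_)
  rw [ae_le_set]
  refine measure_mono_null (t := ⋃ m, frontier (T m).inside) ?_
    (measure_iUnion_null fun m => (T m).volume_frontier)
  rintro x ⟨hx, hxn⟩
  obtain ⟨m, hm⟩ := hT.mem_closure hx
  refine mem_iUnion.2 ⟨m, ?_⟩
  rw [frontier, (T m).isOpen_inside.interior_eq]
  exact ⟨hm, fun h => hxn (mem_iUnion.2 ⟨m, h⟩)⟩

/-- A point at which all adjacent cells give the same value to `τ` is removable for the defect. -/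
lemma sum_defect_eq_zero_near_vertex {ι : Type*} [Fintype ι] {Ω : Set Plane}
    {T : ι → SimplePolygon} (hT : IsPolygonalMesh Ω T)
    {τ : Plane → Matrix (Fin 2) (Fin 2) ℝ} (hτ : MemL2Sym Ω τ) {f : Plane → ℝ}
    (hf : ∀ i, IsWeakDivDiv (T i).inside τ f) {δ : Plane} {A : Matrix (Fin 2) (Fin 2) ℝ}
    (hA : ∀ m, HasValueAt (T m) τ δ A) {ρ : ℝ} (hρΩ : Metric.ball δ ρ ⊆ Ω)
    (hpunct : ∀ v : Plane → ℝ, ContDiff ℝ ∞ v → HasCompactSupport v →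
      tsupport v ⊆ Metric.ball δ ρ \ {δ} → ∑ m, defect (T m).inside τ f v = 0)
    {v : Plane → ℝ} (hv : ContDiff ℝ ∞ v) (hvc : HasCompactSupport v)
    (hvρ : tsupport v ⊆ Metric.ball δ ρ) : ∑ m, defect (T m).inside τ f v = 0 := by
  have hτm : ∀ m a b, MemLp (fun x => τ x a b) 2 (volume.restrict (T m).inside) := fun m a b =>
    (hτ.1 a b).mono_measure (Measure.restrict_mono (hT.inside_subset m) le_rfl)
  let φ : ContDiffBump (0 : Plane) := ⟨1 / 4, 1 / 2, by norm_num, by norm_num⟩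
  have hφ : ContDiff ℝ ∞ (φ : Plane → ℝ) := φ.contDiff
  have hlim : Tendsto (fun r : ℝ => ∑ m, defect (T m).inside (fun x => τ x - A) f
      (v * rescale φ δ r)) (𝓝[>] 0) (𝓝 (∑ _m : ι, 0)) :=
    tendsto_finsetSum _ fun m _ => (hA m).tendsto_defect (hτm m) (hf m).1 hv hvc hφ
      φ.hasCompactSupport φ.tsupport_eq.subset
  rw [Finset.sum_const_zero] at hlim
  -- The sum for `v` is independent of `r`; it equals the sum for `τ - A` and `v φ_r` at every `r >
  -- 0`, hence equals its limit 0.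
  refine tendsto_nhds_unique (tendsto_const_nhds.congr' ?_) hlim
  filter_upwards [self_mem_nhdsWithin] with r (hr : 0 < r)
  have hs := contDiff_rescale hφ δ r
  have hw : ContDiff ℝ ∞ (v * rescale φ δ r) := hv.mul hs
  have hwc : HasCompactSupport (v * rescale φ δ r) := hvc.mul_right
  have hws : tsupport (v * rescale φ δ r) ⊆ Ω :=
    (tsupport_mul_subset_left (f := v) (g := rescale φ δ r)).trans (hvρ.trans hρΩ)
  have hu : ContDiff ℝ ∞ (v * (1 - rescale φ δ r)) := hv.mul (contDiff_const.sub hs)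
  have huc : HasCompactSupport (v * (1 - rescale φ δ r)) := hvc.mul_right
  have hus : tsupport (v * (1 - rescale φ δ r)) ⊆ Metric.ball δ ρ \ {δ} := by
    refine fun x hx => ⟨hvρ (tsupport_mul_subset_left (f := v) hx), ?_⟩
    rintro rfl
    -- The inner radius `1 / 4` of `φ` makes the rescaled cut-off equal to 1 on the ball of radius
    -- `r / 4`.
    refine (closure_minimal (s := Function.support (v * (1 - rescale φ x r)))
      (t := (Metric.ball x (r / 4))ᶜ) ?_ Metric.isOpen_ball.isClosed_compl hx)
      (Metric.mem_ball_self (by linarith))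
    intro y hy hyx
    refine hy ?_
    have : φ (r⁻¹ • (y - x)) = 1 := by
      refine φ.one_of_mem_closedBall ?_
      rw [Metric.mem_ball, dist_eq_norm] at hyx
      rw [mem_closedBall_zero_iff, norm_smul, norm_inv, Real.norm_of_nonneg hr.le,
        inv_mul_le_iff₀ hr]
      change _ ≤ r * (1 / 4)
      linarith
    simp [rescale, this]
  have e : v = v * (1 - rescale φ δ r) + v * rescale φ δ r := by ring
  have hfin : ∀ m, MemLp (fun _ : Plane => (1 : ℝ)) 2 (volume.restrict (T m).inside) := fun m => by
    have := (T m).isFiniteMeasure_restrict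
    exact memLp_const _
  have hconst : IntegrableOn (contractHess (fun _ => A) (v * rescale φ δ r)) Ω := by
    refine Integrable.integrableOn
      (integrable_finsetSum _ fun i _ => integrable_finsetSum _ fun j _ => ?_)
    exact ((contDiff_pderiv (contDiff_pderiv hw j) i).continuous.integrable_of_hasCompactSupport
      (hasCompactSupport_pderiv (hasCompactSupport_pderiv hwc j) i)).const_mul _
  have e1 : ∑ m, defect (T m).inside τ f v = ∑ m, defect (T m).inside τ f (v * (1 - rescale φ δ r))
      + ∑ m, defect (T m).inside τ f (v * rescale φ δ r) := by
    rw [← Finset.sum_add_distrib]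
    refine Finset.sum_congr rfl fun m _ => ?_
    rw [← defect_add (hτm m) (hf m).1 hu huc hw hwc, ← e]
  -- The constant `A` may differ from zero in its contribution to a single cell; only the sum `∫_Ω A
  -- : ∇²(v φ_r)` vanishes. This is why all cells must share the same value.
  rw [e1, hpunct _ hu huc hus, zero_add,
    Finset.sum_congr rfl fun m _ => defect_sub_const (hτm m) hw hwc f A (hfin m),
    Finset.sum_add_distrib, hT.sum_integral hconst, integral_contractHess_const hw hwc hws,
    add_zero]

/-- Conformity excludes a vertex in the relative interior of another cell's edge, so the vertex
hypothesis reaches every cell touching the point. -/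
lemma IsPolygonalMesh.exists_vertex_eq {ι : Type*} {Ω : Set Plane} {T : ι → SimplePolygon}
    (hT : IsPolygonalMesh Ω T) {i m : ι} {k : ZMod (T i).n}
    (hm : (T i).vertex k ∈ closure (T m).inside) : ∃ l, (T m).vertex l = (T i).vertex k := by
  by_cases him : i = m
  · subst him; exact ⟨k, rfl⟩
  have hδ := (T i).vertex_mem_frontier k
  obtain ⟨l, hl⟩ := (T m).exists_mem_edge
    (hT.mem_frontier him (frontier_subset_closure hδ) hm)
  rcases (T m).mem_vertex_or_openEdge hl with ⟨l', hl'⟩ | h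
  · exact ⟨l', hl'.symm⟩
  · rcases hT.conforming m i (Ne.symm him) l k with h' | h'
    · rcases eq_or_eq_of_segment_eq ((T i).vertex_ne k) h' with h'' | h''
      · exact ⟨_, h''.1⟩
      · exact ⟨_, h''.2⟩
    · exact (h'.le_bot ⟨h, left_mem_segment ℝ _ _⟩).elim

/-! ### Gluing the cellwise div div -/

lemma IsWeakDivDiv.congr {U : Set Plane} (hU : MeasurableSet U)
    {τ : Plane → Matrix (Fin 2) (Fin 2) ℝ} {f g : Plane → ℝ} (hf : IsWeakDivDiv U τ f)
    (h : EqOn f g U) : IsWeakDivDiv U τ g := by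
  refine ⟨(memLp_congr_ae (ae_restrict_of_forall_mem hU h)).1 hf.1, fun v hv hc hs => ?_⟩
  rw [← hf.2 v hv hc hs]
  exact setIntegral_congr_fun hU fun x hx => by simp only [h hx]

lemma IsPolygonalMesh.exists_glued_divDiv {ι : Type*} [Fintype ι] {Ω : Set Plane}
    {T : ι → SimplePolygon} (hT : IsPolygonalMesh Ω T)
    {τ : Plane → Matrix (Fin 2) (Fin 2) ℝ} (h : ∀ i, MemHDivDiv (T i).inside τ) :
    ∃ f : Plane → ℝ, MemLp f 2 (volume.restrict Ω) ∧ ∀ i, IsWeakDivDiv (T i).inside τ f := by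
  classical
  choose F hF using fun i => (h i).2
  have hm : ∀ i, MeasurableSet (T i).inside := fun i => (T i).isOpen_inside.measurableSet
  refine ⟨fun x => ∑ i, (T i).inside.indicator (F i) x, ?_, fun i => (hF i).congr (hm i) ?_⟩
  · exact memLp_finsetSum _ fun i _ =>
      ((memLp_indicator_iff_restrict (hm i)).2 (hF i).1).mono_measure Measure.restrict_le_self
  · intro x hx
    beta_reduce
    rw [Finset.sum_eq_single i (fun j _ hji => ?_) (by simp), indicator_of_mem hx]
    exact indicator_of_notMem (fun hxj => (hT.disjoint j i hji).le_bot ⟨hxj, hx⟩) _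

end DivDiv

/-! ### Localization and conclusion -/

open DivDiv in
theorem mainTheorem7 {ι : Type*} (Ω : Set Plane) (T : ι → SimplePolygon)
    (hT : IsPolygonalMesh Ω T)
    (τ : Plane → Matrix (Fin 2) (Fin 2) ℝ) (hτ : MemL2Sym Ω τ)
    (h_cells : ∀ i, MemHDivDiv (T i).inside τ)
    (h_normal : ∀ i (k : ZMod (T i).n), (T i).openEdge k ⊆ Ω →
      ∃ g : Plane → ℝ, ∀ j (l : ZMod (T j).n), (T j).edge l = (T i).edge k →
        HasNormalNormalTrace (T j) τ l g)
    (h_shear : ∀ i (k : ZMod (T i).n), (T i).openEdge k ⊆ Ω →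
      ∃ g : Plane → ℝ, ∀ j (l : ZMod (T j).n), (T j).edge l = (T i).edge k →
        HasShearTrace (T j) τ l ((T i).normal k) g)
    (h_vertex : ∀ i (k : ZMod (T i).n), (T i).vertex k ∈ Ω →
      ∃ A : Matrix (Fin 2) (Fin 2) ℝ, ∀ j (l : ZMod (T j).n),
        (T j).vertex l = (T i).vertex k → HasValueAt (T j) τ ((T i).vertex k) A) :
    MemHDivDiv Ω τ := by
  have := hT.finite
  have := Fintype.ofFinite ι
  obtain ⟨f, hfΩ, hf⟩ := hT.exists_glued_divDiv h_cells
  have hτm : ∀ m a b, MemLp (fun x => τ x a b) 2 (volume.restrict (T m).inside) := fun m a b =>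
    (hτ.1 a b).mono_measure (Measure.restrict_mono (hT.inside_subset m) le_rfl)
  have h0 : ∑ m, defect (T m).inside τ f 0 = 0 :=
    Finset.sum_eq_zero fun m _ => defect_eq_zero_of_disjoint τ f (by simp)
  have hadd : ∀ u v : Plane → ℝ, ContDiff ℝ ∞ u → HasCompactSupport u → ContDiff ℝ ∞ v →
      HasCompactSupport v → ∑ m, defect (T m).inside τ f u = 0 →
      ∑ m, defect (T m).inside τ f v = 0 → ∑ m, defect (T m).inside τ f (u + v) = 0 := by
    intro u v hu huc hv hvc h1 h2
    simp only [defect_add (hτm _) (hf _).1 hu huc hv hvc, Finset.sum_add_distrib, h1, h2,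
      add_zero]
  have hreg : ∀ x ∈ Ω, (∀ i k, x ≠ (T i).vertex k) → ∃ r > 0, ∀ v : Plane → ℝ,
      ContDiff ℝ ∞ v → HasCompactSupport v → tsupport v ⊆ Metric.ball x r →
      ∑ m, defect (T m).inside τ f v = 0 := by
    intro x hx hxv
    rcases hT.mem_cases hx with ⟨i, hi⟩ | ⟨i, k, hk⟩ | ⟨i, k, hk⟩
    · obtain ⟨r, hr, hb⟩ := Metric.isOpen_iff.1 (T i).isOpen_inside x hi
      refine ⟨r, hr, fun v hv hvc hvr => Finset.sum_eq_zero fun m _ => ?_⟩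
      by_cases hmi : m = i
      · subst hmi
        rw [defect, (hf m).2 v hv hvc (hvr.trans hb), sub_self]
      · exact defect_eq_zero_of_disjoint τ f
          ((hT.disjoint i m (Ne.symm hmi)).mono_left (hvr.trans hb))
    · exact sum_defect_eq_zero_near_edge hT hτ hf h_normal h_shear hk hx
    · exact (hxv i k hk).elim
  have hloc : ∀ x ∈ Ω, ∃ r > 0, ∀ v : Plane → ℝ,
      ContDiff ℝ ∞ v → HasCompactSupport v → tsupport v ⊆ Metric.ball x r →
      ∑ m, defect (T m).inside τ f v = 0 := by
    intro x hx
    by_cases hxv : ∀ i k, x ≠ (T i).vertex k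
    · exact hreg x hx hxv
    push Not at hxv
    obtain ⟨i, k, rfl⟩ := hxv
    set δ := (T i).vertex k
    obtain ⟨A, hA⟩ := h_vertex i k hx
    have hA' : ∀ m, HasValueAt (T m) τ δ A := by
      intro m
      by_cases hm : δ ∈ closure (T m).inside
      · obtain ⟨l, hl⟩ := hT.exists_vertex_eq hm
        exact hA m l hl
      · exact hasValueAt_of_notMem_closure hm τ A
    -- There are finitely many vertices, so a small punctured ball around `δ` contains none; `hreg`
    -- applies at each of its points, and a second localization gives the hypothesis on test
    -- functions supported away from `δ`.
    have hfin : (⋃ m, range (T m).vertex \ {δ}).Finite :=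
      finite_iUnion fun m => (finite_range _).subset sdiff_subset
    obtain ⟨ρ₁, hρ₁, hb₁⟩ := Metric.isOpen_iff.1 hT.isOpen δ hx
    obtain ⟨ρ₂, hρ₂, hb₂⟩ := Metric.isOpen_iff.1 hfin.isClosed.isOpen_compl δ (by simp)
    have hb₁' : Metric.ball δ (min ρ₁ ρ₂) ⊆ Ω :=
      (Metric.ball_subset_ball (min_le_left _ _)).trans hb₁
    refine ⟨min ρ₁ ρ₂, lt_min hρ₁ hρ₂, fun v hv hvc hvr =>
      sum_defect_eq_zero_near_vertex hT hτ hf hA' hb₁' ?_ hv hvc hvr⟩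
    intro u hu huc hus
    refine test_induction h0 hadd (fun y hy => hreg y (hb₁' hy.1) ?_) hu huc hus
    rintro m l rfl
    exact hb₂ (Metric.ball_subset_ball (min_le_right _ _) hy.1)
      (mem_iUnion.2 ⟨m, mem_range_self l, hy.2⟩)
  refine ⟨hτ, f, hfΩ, fun v hv hvc hvΩ => ?_⟩
  have key : ∑ m, defect (T m).inside τ f v = 0 := test_induction h0 hadd hloc hv hvc hvΩ
  simp only [defect, Finset.sum_sub_distrib] at key
  rwa [hT.sum_integral (integrableOn_mul hfΩ hv hvc),
    hT.sum_integral (integrableOn_contractHess hτ.1 hv hvc), sub_eq_zero] at key
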